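/- Let $1\le d\le m$ be integers. Let $\mathrm{Inj}(d,m)$ be the space of injective linear maps $\mathbb R^d\to\mathbb R^m$ (an open subset, hence an open submanifold, of the space of all linear maps) and let $V_{m,d}\subset \mathrm{Inj}(d,m)$ be the Stiefel manifold of linear isometries of $\mathbb R^d$ into $\mathbb R^m$, with inclusion $\iota\colon V_{m,d}\hookrightarrow\mathrm{Inj}(d,m)$. Let $\Lambda\colon\mathrm{Inj}(d,m)\to V_{m,d}$ be the Gram--Schmidt map, which sends $\alpha$ to the linear isometry whose columns are obtained by Gram--Schmidt orthonormalization of the columns $\alpha(e_1),\dots,\alpha(e_d)$ of $\alpha$, and let $$\widehat\Lambda\colon \mathrm{Inj}(d,m)\times[0,1]\to\mathrm{Inj}(d,m),\qquad \widehat\Lambda(\alpha,t)=(1-t)\,\alpha+t\,\Lambda(\alpha).$$ (Equivalently, $\widehat\Lambda(\alpha,t)=\alpha\,((1-t)\,\mathrm{id}+t\,\mathsf M(\alpha))$, where $\mathsf M(\alpha)$ is the upper triangular $d\times d$-matrix with $\alpha\,\mathsf M(\alpha)=\Lambda(\alpha)$.) For a smooth form $\omega$ of degree $p$ on $\mathrm{Inj}(d,m)$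 put $\widehat\omega=\pi_*(\widehat\Lambda^*\omega)$, where $\pi_*$ is integration along the fibre of $\mathrm{Inj}(d,m)\times[0,1]\to\mathrm{Inj}(d,m)$, i.e. $(\pi_*\eta)_\alpha(v_1,\dots,v_{p-1})=\int_0^1\eta_{(\alpha,t)}(\partial_t,v_1,\dots,v_{p-1})\,dt$, and $\widehat\omega=0$ if $p=0$. Let $SO(m)$ act on $\mathrm{Inj}(d,m)$ and $V_{m,d}$ by left multiplication. Then: 1. $\omega\mapsto\widehat\omega$ is a linear map $\Omega^p(\mathrm{Inj}(d,m))\to\Omega^{p-1}(\mathrm{Inj}(d,m))$ for every $p\ge1$, it maps $SO(m)$-invariant forms to $SO(m)$-invariant forms, and for every smooth form $\omega$ of any degree $p\ge 0$ on $\mathrm{Inj}(d,m)$, $$\Lambda^*(\iota^*\omega)-\omega=\widehat{d\omega}+d\widehat\omega .$$ 2. For every $p\ge0$, the pullbacks $\iota^*$ and $\Lambda^*$ induce mutually inverse linear isomorphisms between the de Rham cohomologies $H^p(\mathrm{Inj}(d,m))$ and $H^p(V_{m,d})$. 3. For every $p\ge0$, the pullbacks $\iota^*$ and $\Lambda^*$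 induce mutually inverse linear isomorphisms between the $SO(m)$-invariant de Rham cohomologies (closed $SO(m)$-invariant forms modulo exterior derivatives of $SO(m)$-invariant forms) of $\mathrm{Inj}(d,m)$ and $V_{m,d}$. -/

import Mathlib

open Set Function Module
open scoped Manifold ContDiff Topology RealInnerProductSpace

noncomputable section

namespace StiefelForms

section Forms

variable {E : Type*} [NormedAddCommGroup E] [NormedSpace ℝ E]
  {H : Type*} [TopologicalSpace H] {M : Type*} [TopologicalSpace M] [ChartedSpace H M]
  {E' : Type*} [NormedAddCommGroup E'] [NormedSpace ℝ E']
  {H' : Type*} [TopologicalSpace H'] {N : Type*} [TopologicalSpace N] [ChartedSpace H' N]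

/-- A (not necessarily smooth) field of alternating `p`-forms on a manifold `M` modelled on `E`.
The tangent space `TangentSpace I x` of `M` at any point `x` is, by definition, the space `E`
(through the preferred chart at `x`), so that the value at `x` is an alternating `p`-form on the
tangent space of `M` at `x`. -/
abbrev FormField (E : Type*) [NormedAddCommGroup E] [NormedSpace ℝ E] (M : Type*) (p : ℕ) :
    Type _ :=
  M → E [⋀^Fin p]→L[ℝ] ℝ

/-- The differential `d_x f` as a linear map between the model spaces, which are the tangent spaces of
`M` at `x` and of `N` at `f x`. -/
def differentialAt (I : ModelWithCorners ℝ E H) (I' : ModelWithCorners ℝ E' H') (f : M → N)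
    (x : M) : E →L[ℝ] E' :=
  mfderiv I I' f x

/-- The pullback `f^* θ`, i.e.
`(f^* θ)_x (v₁, …, v_p) = θ_{f x} (d_x f v₁, …, d_x f v_p)`. -/
def pullbackField (I : ModelWithCorners ℝ E H) (I' : ModelWithCorners ℝ E' H') (f : M → N) {p : ℕ}
    (θ : FormField E' N p) : FormField E M p :=
  fun x => (θ (f x)).compContinuousLinearMap (differentialAt I I' f x)

end Forms

section Boundaryless

variable {E : Type*} [NormedAddCommGroup E] [NormedSpace ℝ E]
  {M : Type*} [TopologicalSpace M] [ChartedSpace E M]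
  {E' : Type*} [NormedAddCommGroup E'] [NormedSpace ℝ E']
  {N : Type*} [TopologicalSpace N] [ChartedSpace E' N]

/-- The pullback of forms along a map of manifolds without boundary. -/
abbrev pull (f : M → N) {p : ℕ} (θ : FormField E' N p) : FormField E M p :=
  pullbackField 𝓘(ℝ, E) 𝓘(ℝ, E') f θ

/-- The coordinate expression of `θ` in the chart at `x`: the pullback of `θ` along the inverse
of the chart (meaningful on the target of the chart). -/
def localRep (x : M) {p : ℕ} (θ : FormField E M p) : E → E [⋀^Fin p]→L[ℝ] ℝ :=
  pullbackField 𝓘(ℝ, E) 𝓘(ℝ, E) (chartAt E x).symm θ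

/-- A form is smooth if all its coordinate expressions are smooth. -/
def IsSmoothForm {p : ℕ} (θ : FormField E M p) : Prop :=
  ∀ x : M, ContDiffOn ℝ ∞ (localRep x θ) (chartAt E x).target

/-- The exterior derivative of a form: at `x`, the exterior derivative of the coordinate expression
in the chart at `x`, pulled back along the chart. -/
def extDerivField {p : ℕ} (θ : FormField E M p) : FormField E M (p + 1) :=
  fun x => (extDeriv (localRep x θ) (chartAt E x x)).compContinuousLinearMap
    (differentialAt 𝓘(ℝ, E) 𝓘(ℝ, E) (chartAt E x) x)

lemma localRep_add (x : M) {p : ℕ} (θ η : FormField E M p) :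
    localRep x (θ + η) = localRep x θ + localRep x η := by
  ext y v; simp [localRep, pullbackField]

lemma localRep_smul (x : M) {p : ℕ} (c : ℝ) (θ : FormField E M p) :
    localRep x (c • θ) = c • localRep x θ := by
  ext y v; simp [localRep, pullbackField]

variable (E M) in
/-- The smooth forms, as a linear subspace of the space of all fields of alternating forms. -/
def smoothForms (p : ℕ) : Submodule ℝ (FormField E M p) where
  carrier := {θ | IsSmoothForm θ}
  add_mem' {θ η} hθ hη x := by
    rw [localRep_add]; exact (hθ x).add (hη x)
  zero_mem' x := by
    have : localRep x (0 : FormField E M p) = 0 := by ext y v; simp [localRep, pullbackField]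
    rw [this]; exact contDiffOn_const
  smul_mem' c θ hθ x := by
    rw [localRep_smul]; exact contDiffOn_const.smul (hθ x)

lemma IsSmoothForm.differentiableAt {p : ℕ} {θ : FormField E M p} (h : IsSmoothForm θ) (x : M)
    {y : E} (hy : y ∈ (chartAt E x).target) : DifferentiableAt ℝ (localRep x θ) y :=
  ((h x).contDiffAt ((chartAt E x).open_target.mem_nhds hy)).differentiableAt (by simp)

lemma extDerivField_add {p : ℕ} {θ η : FormField E M p} (hθ : IsSmoothForm θ)
    (hη : IsSmoothForm η) : extDerivField (θ + η) = extDerivField θ + extDerivField η := by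
  ext x v
  have hx := mem_chart_target E x
  simp [extDerivField, localRep_add, extDeriv_add (hθ.differentiableAt x hx)
    (hη.differentiableAt x hx)]

lemma extDerivField_smul {p : ℕ} (c : ℝ) (θ : FormField E M p) :
    extDerivField (c • θ) = c • extDerivField θ := by
  ext x v
  simp [extDerivField, localRep_smul, extDeriv_smul]

variable (E M) in
/-- `Ω^p(M)`, the real vector space of smooth differential `p`-forms on `M`. -/
def DiffForm (p : ℕ) : Type _ := smoothForms E M p

instance (p : ℕ) : AddCommGroup (DiffForm E M p) :=
  inferInstanceAs (AddCommGroup (smoothForms E M p))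

instance (p : ℕ) : Module ℝ (DiffForm E M p) :=
  inferInstanceAs (Module ℝ (smoothForms E M p))

/-- The underlying field of alternating forms of a smooth form. -/
def DiffForm.field {p : ℕ} (θ : DiffForm E M p) : FormField E M p := Subtype.val θ

lemma DiffForm.smooth {p : ℕ} (θ : DiffForm E M p) : IsSmoothForm θ.field := Subtype.property θ

@[ext] lemma DiffForm.ext {p : ℕ} {θ η : DiffForm E M p} (h : θ.field = η.field) : θ = η :=
  Subtype.ext h

@[simp] lemma DiffForm.field_zero {p : ℕ} : (0 : DiffForm E M p).field = 0 := rfl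

@[simp] lemma DiffForm.field_add {p : ℕ} (θ η : DiffForm E M p) :
    (θ + η).field = θ.field + η.field := rfl

@[simp] lemma DiffForm.field_smul {p : ℕ} (c : ℝ) (θ : DiffForm E M p) :
    (c • θ).field = c • θ.field := rfl

variable [IsManifold 𝓘(ℝ, E) ∞ M]

/-- The coordinate expression of the exterior derivative is the exterior derivative of the
coordinate expression. -/
lemma localRep_extDerivField {p : ℕ} {θ : FormField E M p} (h : IsSmoothForm θ) (x₀ : M) {y : E}
    (hy : y ∈ (chartAt E x₀).target) :
    localRep x₀ (extDerivField θ) y = extDeriv (localRep x₀ θ) y := by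
  set e₀ := chartAt E x₀ with he₀
  set x := e₀.symm y with hx
  set e := chartAt E x with he
  have hxe : x ∈ e.source := mem_chart_source E x
  have hE₀ : e₀.MDifferentiable 𝓘(ℝ, E) 𝓘(ℝ, E) := mdifferentiable_chart x₀
  have hE : e.MDifferentiable 𝓘(ℝ, E) 𝓘(ℝ, E) := mdifferentiable_chart x
  have hτ : ContDiffOn ℝ ∞ (e ∘ e₀.symm) (e₀.symm ≫ₕ e).source := by
    have h1 : ContMDiffOn 𝓘(ℝ, E) 𝓘(ℝ, E) ∞ (e ∘ e₀.symm) (e₀.symm ≫ₕ e).source := by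
      refine (contMDiffOn_chart (I := 𝓘(ℝ, E)) (n := ∞) (x := x)).comp
        ((contMDiffOn_chart_symm (I := 𝓘(ℝ, E)) (n := ∞) (x := x₀)).mono ?_) ?_
      · intro z hz; simp at hz; exact hz.1
      · intro z hz; simp at hz; exact hz.2
    exact contMDiffOn_iff_contDiffOn.1 h1
  have hopen : IsOpen (e₀.symm ≫ₕ e).source := (e₀.symm ≫ₕ e).open_source
  have hys : y ∈ (e₀.symm ≫ₕ e).source := by simp [hy, hxe, ← hx]
  have hnhds := hopen.mem_nhds hys
  have hrep : localRep x₀ θ =ᶠ[𝓝 y] fun z =>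
      (localRep x θ ((e ∘ e₀.symm) z)).compContinuousLinearMap (fderiv ℝ (e ∘ e₀.symm) z) := by
    filter_upwards [hnhds] with z hz
    have hz1 : z ∈ e₀.target := by simp at hz; exact hz.1
    have hz2 : e₀.symm z ∈ e.source := by simp at hz; exact hz.2
    have h1 := hE₀.mdifferentiableAt_symm hz1
    have h2 := hE.mdifferentiableAt hz2
    have h4 : mfderiv 𝓘(ℝ, E) 𝓘(ℝ, E) (e ∘ e₀.symm) z = _ := mfderiv_comp z h2 h1
    have h5 := hE.symm_comp_deriv hz2
    rw [← mfderiv_eq_fderiv, h4]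
    ext v
    change θ (e₀.symm z) (fun i => mfderiv 𝓘(ℝ, E) 𝓘(ℝ, E) e₀.symm z (v i)) =
      θ (e.symm (e (e₀.symm z))) (fun i => mfderiv 𝓘(ℝ, E) 𝓘(ℝ, E) e.symm (e (e₀.symm z))
        (mfderiv 𝓘(ℝ, E) 𝓘(ℝ, E) e (e₀.symm z) (mfderiv 𝓘(ℝ, E) 𝓘(ℝ, E) e₀.symm z (v i))))
    rw [e.left_inv hz2]
    congr 1
    ext i
    exact (DFunLike.congr_fun h5 (mfderiv 𝓘(ℝ, E) 𝓘(ℝ, E) e₀.symm z (v i))).symm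
  rw [hrep.extDeriv_eq, extDeriv_pullback (r := ∞) ?_ (hτ.contDiffAt hnhds)
    (by simp only [minSmoothness_of_isRCLikeNormedField]; exact WithTop.coe_le_coe.2 (le_top : (2 : ℕ∞) ≤ ⊤))]
  · have h4 : mfderiv 𝓘(ℝ, E) 𝓘(ℝ, E) (e ∘ e₀.symm) y = _ :=
      mfderiv_comp y (hE.mdifferentiableAt hxe) (hE₀.mdifferentiableAt_symm hy)
    rw [← mfderiv_eq_fderiv, h4]
    rfl
  · exact h.differentiableAt x (e.map_source hxe)

variable (E M) in
/-- The exterior derivative `d : Ω^p(M) → Ω^{p+1}(M)`. -/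
def extD (p : ℕ) : DiffForm E M p →ₗ[ℝ] DiffForm E M (p + 1) where
  toFun θ := ⟨extDerivField θ.field, fun x => by
    have h : ContDiffOn ℝ ∞ (extDeriv (localRep x θ.field)) (chartAt E x).target := by
      have h1 := (θ.smooth x).fderiv_of_isOpen (m := ∞) (chartAt E x).open_target (by simp)
      exact (ContinuousAlternatingMap.alternatizeUncurryFinCLM ℝ E ℝ).contDiff.comp_contDiffOn h1
    exact h.congr fun y hy => localRep_extDerivField θ.smooth x hy⟩
  map_add' θ η := DiffForm.ext (extDerivField_add θ.smooth η.smooth)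
  map_smul' c θ := DiffForm.ext (extDerivField_smul c θ.field)

variable (E M) in
/-- The smooth `p`-forms `θ` on `M` that are left-invariant under the action of `G`,
i.e. `g^* θ = θ` for all `g` in `G`. -/
def invariantForms (G : Type*) [Group G] [MulAction G M] (p : ℕ) :
    Submodule ℝ (DiffForm E M p) where
  carrier := {θ | ∀ g : G, pull (g • · : M → M) θ.field = θ.field}
  add_mem' {θ η} hθ hη g := by
    have h := congrArg₂ (· + ·) (hθ g) (hη g)
    rw [DiffForm.field_add]
    refine Eq.trans ?_ h
    ext x v; simp [pullbackField]
  zero_mem' g := by ext x v; simp [pullbackField]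
  smul_mem' c θ hθ g := by
    have h := congrArg (c • ·) (hθ g)
    rw [DiffForm.field_smul]
    refine Eq.trans ?_ h
    ext x v; simp [pullbackField]

/-- The closed `p`-forms in a family `S` of spaces of smooth forms on `M`. -/
def cocycles (S : ∀ p, Submodule ℝ (DiffForm E M p)) (p : ℕ) :
    Submodule ℝ (DiffForm E M p) :=
  S p ⊓ LinearMap.ker (extD E M p)

/-- The exact `p`-forms `d η`, `η` a `(p-1)`-form in the family `S`. -/
def coboundaries (S : ∀ p, Submodule ℝ (DiffForm E M p)) :
    ∀ p, Submodule ℝ (DiffForm E M p)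
  | 0 => ⊥
  | p + 1 => (S p).map (extD E M p)

/-- The `p`-th cohomology (closed modulo exact forms) of a family `S` of spaces of smooth forms. -/
abbrev Cohomology (S : ∀ p, Submodule ℝ (DiffForm E M p)) (p : ℕ) : Type _ :=
  cocycles S p ⧸ (coboundaries S p).submoduleOf (cocycles S p)

variable (E M) in
/-- The family of all smooth forms; its cohomology is the de Rham cohomology of `M`. -/
abbrev allForms : ∀ p, Submodule ℝ (DiffForm E M p) := fun _ => ⊤

/-- The linear map `L` between cohomologies is given by pullback along `f : M → N`: the pullback of
each closed form `θ` (in the family `T`) on `N` is a closed form (in the family `S`) on `M`, and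
`L [θ] = [f^* θ]`. -/
def IsInducedByPullback [IsManifold 𝓘(ℝ, E') ∞ N] (f : M → N)
    {S : ∀ p, Submodule ℝ (DiffForm E M p)} {T : ∀ p, Submodule ℝ (DiffForm E' N p)}
    {p : ℕ} (L : Cohomology T p →ₗ[ℝ] Cohomology S p) : Prop :=
  ∀ θ : cocycles T p, ∃ η : cocycles S p, η.1.field = pull f θ.1.field ∧
    L (Submodule.Quotient.mk θ) = Submodule.Quotient.mk η

end Boundaryless

section Fibre

variable {E : Type*} [NormedAddCommGroup E] [NormedSpace ℝ E] {M : Type*}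

/-- Integration along the fibre of the trivial fibration `M × [0,1] → M`:
`(π_* η)_x (v₁, …, v_p) = ∫₀¹ η_{(x,t)} (∂_t, (v₁, 0), …, (v_p, 0)) dt`.
Here `E × EuclideanSpace ℝ (Fin 1)` is the tangent space of `M × [0,1]`, and `oneTangentSpaceIcc t`
is the unit tangent vector `∂_t` of the interval at `t`. -/
def fibreIntegral {p : ℕ}
    (η : FormField (E × EuclideanSpace ℝ (Fin 1)) (M × Icc (0 : ℝ) 1) (p + 1)) : FormField E M p :=
  fun x => ∫ t : Icc (0 : ℝ) 1,
    ((η (x, t)).curryLeft (0, (oneTangentSpaceIcc t : TangentSpace (𝓡∂ 1) t))).compContinuousLinearMap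
      (ContinuousLinearMap.inl ℝ E (EuclideanSpace ℝ (Fin 1)))

end Fibre

section Spaces

variable {d m : ℕ}

/-- The space of linear maps `ℝ^d → ℝ^m`. -/
abbrev LinMap (d m : ℕ) : Type := EuclideanSpace ℝ (Fin d) →L[ℝ] EuclideanSpace ℝ (Fin m)

/-- The space `Inj(d,m)` of injective linear maps `ℝ^d → ℝ^m`, an open subset of the space of all
linear maps (and, as such, a smooth manifold). -/
def Inj (d m : ℕ) : TopologicalSpace.Opens (LinMap d m) :=
  ⟨{α | Injective α}, ContinuousLinearMap.isOpen_injective⟩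

/-- The Stiefel manifold `V_{m,d}`: the set of linear isometries of `ℝ^d` into `ℝ^m`. -/
@[ext]
structure Stiefel (m d : ℕ) : Type where
  /-- the underlying linear map -/
  val : LinMap d m
  norm_map : ∀ x, ‖val x‖ = ‖x‖

/-- The Stiefel manifold has the topology induced from the space of all linear maps. -/
instance : TopologicalSpace (Stiefel m d) :=
  TopologicalSpace.induced Stiefel.val inferInstance

lemma continuous_stiefelVal : Continuous (Stiefel.val : Stiefel m d → LinMap d m) :=
  continuous_induced_dom

/-- The columns `α e₁, …, α e_d` of a linear map. -/
def col (α : LinMap d m) (j : Fin d) : EuclideanSpace ℝ (Fin m) := α (EuclideanSpace.single j 1)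

/-- The linear map with given columns. -/
def ofCols (v : Fin d → EuclideanSpace ℝ (Fin m)) : LinMap d m :=
  ∑ j, (EuclideanSpace.proj j : EuclideanSpace ℝ (Fin d) →L[ℝ] ℝ).smulRight (v j)

lemma ofCols_apply (v : Fin d → EuclideanSpace ℝ (Fin m)) (x : EuclideanSpace ℝ (Fin d)) :
    ofCols v x = ∑ j, x j • v j := by
  simp [ofCols]

@[simp] lemma col_ofCols (v : Fin d → EuclideanSpace ℝ (Fin m)) : col (ofCols v) = v := by
  ext1 j
  simp [col, ofCols_apply]

@[simp] lemma ofCols_col (α : LinMap d m) : ofCols (col α) = α := by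
  ext1 x
  conv_rhs => rw [← (EuclideanSpace.basisFun (Fin d) ℝ).sum_repr x]
  simp [ofCols_apply, col]

lemma col_injective : Injective (col : LinMap d m → _) := LeftInverse.injective ofCols_col

lemma injective_iff_col (α : LinMap d m) : Injective α ↔ LinearIndependent ℝ (col α) := by
  rw [Fintype.linearIndependent_iff, injective_iff_map_eq_zero]
  constructor
  · intro h g hg j
    have := h (WithLp.toLp 2 g) (by rw [← ofCols_col α, ofCols_apply]; simpa using hg)
    simpa using congrArg (fun x : EuclideanSpace ℝ (Fin d) => x j) this
  · intro h x hx
    rw [← ofCols_col α, ofCols_apply] at hx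
    ext j
    exact h x hx j

lemma isometry_iff_col (α : LinMap d m) : (∀ x, ‖α x‖ = ‖x‖) ↔ Orthonormal ℝ (col α) := by
  constructor
  · intro h
    let L : EuclideanSpace ℝ (Fin d) →ₗᵢ[ℝ] EuclideanSpace ℝ (Fin m) := ⟨α, h⟩
    have := (EuclideanSpace.basisFun (Fin d) ℝ).orthonormal.comp_linearIsometry L
    convert! this using 1
    ext1 j
    simp [col, L]
  · intro h x
    have h1 : ‖α x‖ ^ 2 = ‖x‖ ^ 2 := by
      rw [← ofCols_col α, ofCols_apply, ← real_inner_self_eq_norm_sq, h.inner_sum,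
        EuclideanSpace.real_norm_sq_eq]
      simp [sq]
    exact (sq_eq_sq₀ (norm_nonneg _) (norm_nonneg _)).1 h1

/-- The natural inclusion `ι : V_{m,d} → Inj(d,m)`. -/
def incl (m d : ℕ) (α : Stiefel m d) : Inj d m :=
  ⟨α.1, (AddMonoidHomClass.isometry_of_norm α.1 α.2).injective⟩

/-- The Gram--Schmidt map `Λ : Inj(d,m) → V_{m,d}`, which applies the Gram--Schmidt
orthonormalization to the columns of `α`. -/
def gramSchmidtMap (m d : ℕ) (α : Inj d m) : Stiefel m d :=
  ⟨ofCols (InnerProductSpace.gramSchmidtNormed ℝ (col α.1)), by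
    rw [isometry_iff_col, col_ofCols]
    exact InnerProductSpace.gramSchmidtNormed_orthonormal ((injective_iff_col α.1).1 α.2)⟩

lemma inner_gramSchmidt_self_pos {v : Fin d → EuclideanSpace ℝ (Fin m)}
    (hv : LinearIndependent ℝ v) (k : Fin d) :
    0 < ⟪InnerProductSpace.gramSchmidt ℝ v k, v k⟫ := by
  have h0 := InnerProductSpace.gramSchmidt_ne_zero k hv
  have h : ⟪InnerProductSpace.gramSchmidt ℝ v k, v k⟫ =
      ‖InnerProductSpace.gramSchmidt ℝ v k‖ ^ 2 := by
    conv_lhs => rw [InnerProductSpace.gramSchmidt_def'' ℝ v k]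
    rw [inner_add_right, real_inner_self_eq_norm_sq, inner_sum, Finset.sum_eq_zero, add_zero]
    intro i hi
    rw [inner_smul_right, InnerProductSpace.gramSchmidt_orthogonal ℝ v (Finset.mem_Iio.1 hi).ne',
      mul_zero]
  rw [h]
  positivity

lemma homotopy_injective (α : Inj d m) {t : ℝ} (h0 : 0 ≤ t) (h1 : t ≤ 1) :
    Injective ((1 - t) • α.1 + t • (gramSchmidtMap m d α).1) := by
  set v := col α.1 with hv
  have hli : LinearIndependent ℝ v := (injective_iff_col α.1).1 α.2
  set e := InnerProductSpace.gramSchmidtNormed ℝ v with he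
  have hon : Orthonormal ℝ e := InnerProductSpace.gramSchmidtNormed_orthonormal hli
  have hcol : col ((1 - t) • α.1 + t • (gramSchmidtMap m d α).1) =
      fun j => (1 - t) • v j + t • e j := by
    have : col (gramSchmidtMap m d α).1 = e := col_ofCols _
    ext1 j
    rw [← this]
    simp [col, hv]
  have hpos : ∀ k, 0 < ⟪e k, v k⟫ := fun k => by
    have h := inner_gramSchmidt_self_pos hli k
    have h' : 0 < ‖InnerProductSpace.gramSchmidt ℝ v k‖ :=
      norm_pos_iff.2 (InnerProductSpace.gramSchmidt_ne_zero k hli)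
    simp only [he, InnerProductSpace.gramSchmidtNormed, real_inner_smul_left]
    simp only [RCLike.ofReal_real_eq_id, id_eq]
    positivity
  have htri : ∀ j k, j < k → ⟪e k, v j⟫ = 0 := fun j k hjk => by
    simp [he, InnerProductSpace.gramSchmidtNormed, real_inner_smul_left,
      InnerProductSpace.gramSchmidt_inv_triangular ℝ v hjk]
  rw [injective_iff_col, hcol, Fintype.linearIndependent_iff]
  intro x hx
  by_contra! hne
  obtain ⟨i₀, hi₀⟩ := hne
  let s : Finset (Fin d) := Finset.univ.filter fun j => x j ≠ 0
  have hs : s.Nonempty := ⟨i₀, by simp [s, hi₀]⟩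
  set k := s.max' hs with hk
  have hxk : x k ≠ 0 := by
    have := s.max'_mem hs
    simpa [s] using this
  have hgt : ∀ j, k < j → x j = 0 := fun j hj => by
    by_contra hxj
    exact absurd (s.le_max' j (by simp [s, hxj])) (not_le.2 hj)
  have hin := congrArg (fun z => ⟪e k, z⟫) hx
  simp only [inner_sum, inner_zero_right, real_inner_smul_right, inner_add_right] at hin
  rw [Finset.sum_eq_single k] at hin
  · have hkk : ⟪e k, e k⟫ = 1 := by rw [real_inner_self_eq_norm_sq, hon.1 k]; norm_num
    rw [hkk] at hin
    have h2 : 0 < (1 - t) * ⟪e k, v k⟫ + t * 1 := by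
      rcases h0.eq_or_lt with h | h
      · simp [← h, hpos k]
      · have := mul_nonneg (sub_nonneg.2 h1) (hpos k).le
        linarith
    exact (mul_ne_zero hxk h2.ne') hin
  · intro j _ hjk
    rcases lt_or_gt_of_ne hjk with h | h
    · rw [htri j k h, hon.2 hjk.symm]; simp
    · rw [hgt j h, zero_mul]
  · simp

/-- The homotopy `Inj(d,m) × [0,1] → Inj(d,m)` from the identity to `ι ∘ Λ`. If `M(α)` is the upper
triangular `d × d`-matrix with `α M(α) = Λ(α)`, it sends `(α, t)` to
`α ((1 - t) id + t M(α)) = (1 - t) α + t Λ(α)`. -/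
def homotopy (m d : ℕ) (q : Inj d m × Icc (0 : ℝ) 1) : Inj d m :=
  ⟨(1 - (q.2 : ℝ)) • q.1.1 + (q.2 : ℝ) • (gramSchmidtMap m d q.1).1,
    homotopy_injective q.1 q.2.2.1 q.2.2.2⟩

/-- The special orthogonal group `SO(m)`. -/
abbrev SO (m : ℕ) := Matrix.specialOrthogonalGroup (Fin m) ℝ

/-- The linear map `ℝ^m → ℝ^m` given by an element of `SO(m)`. -/
def SO.toLin (g : SO m) : LinMap m m := Matrix.toEuclideanCLM (n := Fin m) (𝕜 := ℝ) g.1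

lemma SO.norm_toLin (g : SO m) (x : EuclideanSpace ℝ (Fin m)) : ‖SO.toLin g x‖ = ‖x‖ := by
  refine ContinuousLinearMap.norm_map_of_mem_unitary ?_ x
  have h : g.1 ∈ Matrix.unitaryGroup (Fin m) ℝ := (Matrix.mem_specialOrthogonalGroup_iff.1 g.2).1
  exact Unitary.map_mem (Matrix.toEuclideanCLM (n := Fin m) (𝕜 := ℝ)) h

lemma SO.toLin_one : SO.toLin (1 : SO m) = ContinuousLinearMap.id ℝ _ :=
  map_one (Matrix.toEuclideanCLM (n := Fin m) (𝕜 := ℝ))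

lemma SO.toLin_mul (g h : SO m) : SO.toLin (g * h) = (SO.toLin g).comp (SO.toLin h) :=
  map_mul (Matrix.toEuclideanCLM (n := Fin m) (𝕜 := ℝ)) g.1 h.1

/-- The left action of `SO(m)` on `Inj(d,m)` by left multiplication. -/
instance : MulAction (SO m) (Inj d m) where
  smul g α := ⟨(SO.toLin g).comp α.1,
    (AddMonoidHomClass.isometry_of_norm _ (SO.norm_toLin g)).injective.comp α.2⟩
  one_smul α := Subtype.ext (by
    change (SO.toLin 1).comp α.1 = α.1
    rw [SO.toLin_one, ContinuousLinearMap.id_comp])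
  mul_smul g h α := Subtype.ext (by
    change (SO.toLin (g * h)).comp α.1 = (SO.toLin g).comp ((SO.toLin h).comp α.1)
    rw [SO.toLin_mul, ContinuousLinearMap.comp_assoc])

/-- The left action of `SO(m)` on `V_{m,d}` by left multiplication. -/
instance : MulAction (SO m) (Stiefel m d) where
  smul g α := ⟨(SO.toLin g).comp α.1, fun x => (SO.norm_toLin g _).trans (α.2 x)⟩
  one_smul α := Stiefel.ext (by
    change (SO.toLin 1).comp α.1 = α.1
    rw [SO.toLin_one, ContinuousLinearMap.id_comp])
  mul_smul g h α := Stiefel.ext (by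
    change (SO.toLin (g * h)).comp α.1 = (SO.toLin g).comp ((SO.toLin h).comp α.1)
    rw [SO.toLin_mul, ContinuousLinearMap.comp_assoc])

/-! ### The smooth structure of the Stiefel manifold

The chart at `a` is the orthogonal projection of a neighbourhood of `a` in `V_{m,d}` to the tangent
space `T_a = {ξ | aᵀ ξ + ξᵀ a = 0}` of `V_{m,d}` at `a`, followed by a linear isomorphism of `T_a`
with the model space. -/

/-- The matrix `aᵀ ξ + ξᵀ a`. -/
def symPair (a ξ : LinMap d m) (i j : Fin d) : ℝ := ⟪col a i, col ξ j⟫ + ⟪col ξ i, col a j⟫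

/-- The Gram matrix `xᵀ x`. -/
def gram (x : LinMap d m) (i j : Fin d) : ℝ := ⟪col x i, col x j⟫

/-- The product `a S` for a `d × d`-matrix `S`. -/
def mulMat (a : LinMap d m) (S : Fin d → Fin d → ℝ) : LinMap d m :=
  ofCols fun j => ∑ i, S i j • col a i

/-- The tangent space `{ξ | aᵀ ξ + ξᵀ a = 0}` of the Stiefel manifold at `a`. -/
def tangentAt (a : LinMap d m) : Submodule ℝ (LinMap d m) where
  carrier := {ξ | ∀ i j, symPair a ξ i j = 0}
  add_mem' {ξ η} hξ hη i j := by
    have h1 := hξ i j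
    have h2 := hη i j
    simp only [symPair, col, add_apply, inner_add_left, inner_add_right] at *
    linarith
  zero_mem' i j := by simp [symPair, col]
  smul_mem' c ξ hξ i j := by
    have h1 := hξ i j
    simp only [symPair, col, smul_apply, real_inner_smul_left,
      real_inner_smul_right] at *
    rw [← mul_add, h1, mul_zero]

lemma inner_col_mulMat {a : LinMap d m} (ha : Orthonormal ℝ (col a)) (S : Fin d → Fin d → ℝ)
    (i j : Fin d) : ⟪col a i, col (mulMat a S) j⟫ = S i j := by
  simp only [mulMat, col_ofCols]
  exact ha.inner_right_fintype _ _

lemma symPair_mulMat {a : LinMap d m} (ha : Orthonormal ℝ (col a)) (S : Fin d → Fin d → ℝ)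
    (i j : Fin d) : symPair a (mulMat a S) i j = S i j + S j i := by
  rw [symPair, inner_col_mulMat ha, real_inner_comm, inner_col_mulMat ha]

lemma symPair_comm (a ξ : LinMap d m) (i j : Fin d) : symPair a ξ i j = symPair a ξ j i := by
  rw [symPair, symPair, real_inner_comm, add_comm, real_inner_comm]

lemma symPair_sub_smul (a ξ η : LinMap d m) (c : ℝ) (i j : Fin d) :
    symPair a (ξ - c • η) i j = symPair a ξ i j - c * symPair a η i j := by
  simp only [symPair, col, sub_apply, smul_apply,
    inner_sub_left, inner_sub_right, real_inner_smul_left, real_inner_smul_right]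
  ring

lemma finrank_linMap : finrank ℝ (LinMap d m) = m * d := by
  have h : finrank ℝ (LinMap d m) =
      finrank ℝ (EuclideanSpace ℝ (Fin d) →ₗ[ℝ] EuclideanSpace ℝ (Fin m)) :=
    (LinearMap.toContinuousLinearMap (𝕜 := ℝ) (E := EuclideanSpace ℝ (Fin d))
      (F' := EuclideanSpace ℝ (Fin m))).symm.finrank_eq
  rw [h, finrank_linearMap]
  simp [mul_comm]

lemma finrank_tangentAt {a : LinMap d m} (ha : Orthonormal ℝ (col a)) :
    finrank ℝ (tangentAt a) = m * d - (d + 1).choose 2 := by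
  let L : LinMap d m →ₗ[ℝ] (Sym2 (Fin d) → ℝ) :=
    { toFun := fun ξ => Sym2.lift ⟨symPair a ξ, symPair_comm a ξ⟩
      map_add' := fun ξ η => by
        ext z
        induction z with | _ i j
        simp [symPair, col, inner_add_left, inner_add_right]
        ring
      map_smul' := fun c ξ => by
        ext z
        induction z with | _ i j
        simp [symPair, col, real_inner_smul_left, real_inner_smul_right]
        ring }
  have hker : LinearMap.ker L = tangentAt a := by
    ext ξ
    rw [LinearMap.mem_ker]
    constructor
    · intro h i j
      exact congrFun h s(i, j)
    · intro h
      ext z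
      induction z with | _ i j
      exact h i j
  have hsurj : LinearMap.range L = ⊤ := by
    rw [LinearMap.range_eq_top]
    intro f
    refine ⟨mulMat a fun i j => f s(i, j) / 2, ?_⟩
    ext z
    induction z with | _ i j
    change symPair a _ i j = _
    rw [symPair_mulMat ha, Sym2.eq_swap (a := j)]
    ring
  have h := L.finrank_range_add_finrank_ker
  rw [hsurj, hker, finrank_top, finrank_linMap] at h
  have hc : finrank ℝ (Sym2 (Fin d) → ℝ) = (d + 1).choose 2 := by
    rw [finrank_fintype_fun_eq_card, Sym2.card, Fintype.card_fin]
  omega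

/-- The orthogonal projection `ξ ↦ ξ - a (aᵀ ξ + ξᵀ a) / 2` to the tangent space at `a`. -/
def tangentProj (a ξ : LinMap d m) : LinMap d m := ξ - (1 / 2 : ℝ) • mulMat a (symPair a ξ)

lemma tangentProj_mem {a : LinMap d m} (ha : Orthonormal ℝ (col a)) (ξ : LinMap d m) :
    tangentProj a ξ ∈ tangentAt a := by
  intro i j
  rw [tangentProj, symPair_sub_smul, symPair_mulMat ha, symPair_comm a ξ j i]
  ring

/-- The auxiliary local diffeomorphism `x ↦ tangentProj a x + a (xᵀ x) / 2` of the space of all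
linear maps, which straightens the Stiefel manifold near `a`. -/
def straighten (a x : LinMap d m) : LinMap d m :=
  tangentProj a x + (1 / 2 : ℝ) • mulMat a (gram x)

lemma mulMat_gram_self (a : LinMap d m) {x : LinMap d m}
    (hx : Orthonormal ℝ (col x)) : mulMat a (gram x) = a := by
  apply col_injective
  ext1 j
  simp [mulMat, gram, orthonormal_iff_ite.1 hx]

lemma straighten_eq {a : LinMap d m} (ha : Orthonormal ℝ (col a)) (x : LinMap d m) :
    straighten a x = x - (1 / 2 : ℝ) • a + (1 / 2 : ℝ) • mulMat a (gram (x - a)) := by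
  have h : mulMat a (gram (x - a)) = mulMat a (gram x) - mulMat a (symPair a x) +
      mulMat a (gram a) := by
    apply col_injective
    have h1 : ∀ y z : LinMap d m, ∀ j, col (y + z) j = col y j + col z j := fun _ _ _ => rfl
    have h2 : ∀ y z : LinMap d m, ∀ j, col (y - z) j = col y j - col z j := fun _ _ _ => rfl
    ext1 j
    simp only [h1, h2, mulMat, col_ofCols]
    rw [← Finset.sum_sub_distrib, ← Finset.sum_add_distrib]
    refine Finset.sum_congr rfl fun i _ => ?_
    rw [← sub_smul, ← add_smul]
    congr 1
    simp only [gram, symPair, h2, inner_sub_left, inner_sub_right]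
    ring
  rw [mulMat_gram_self a ha] at h
  rw [h, straighten, tangentProj]
  module

lemma straighten_of_isometry (a : LinMap d m) {x : LinMap d m}
    (hx : Orthonormal ℝ (col x)) : straighten a x = tangentProj a x + (1 / 2 : ℝ) • a := by
  rw [straighten, mulMat_gram_self a hx]

lemma isometry_of_straighten {a : LinMap d m} (ha : Orthonormal ℝ (col a)) {x : LinMap d m}
    (hx : straighten a x - (1 / 2 : ℝ) • a ∈ tangentAt a) : Orthonormal ℝ (col x) := by
  rw [orthonormal_iff_ite]
  intro i j
  have h1 := hx i j
  have h2 := tangentProj_mem ha x i j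
  have h3 : straighten a x - (1 / 2 : ℝ) • a =
      (tangentProj a x - (-(1 / 2) : ℝ) • mulMat a (gram x)) - (1 / 2 : ℝ) • mulMat a (gram a) := by
    rw [mulMat_gram_self a ha, straighten]
    module
  have h4 : gram x j i = gram x i j := real_inner_comm _ _
  have h5 : gram a j i = gram a i j := real_inner_comm _ _
  rw [h3, symPair_sub_smul, symPair_sub_smul, h2, symPair_mulMat ha, symPair_mulMat ha, h4, h5] at h1
  have h6 : gram a i j = if i = j then 1 else 0 := orthonormal_iff_ite.1 ha i j
  rw [← h6]
  change gram x i j = _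
  linarith

lemma contDiff_mulMat (a : LinMap d m) {S : LinMap d m → Fin d → Fin d → ℝ}
    (hS : ∀ i j, ContDiff ℝ ∞ fun x => S x i j) : ContDiff ℝ ∞ fun x => mulMat a (S x) := by
  unfold mulMat ofCols
  refine ContDiff.sum fun j _ => ContDiff.smulRight contDiff_const ?_
  exact ContDiff.sum fun i _ => (hS i j).smul contDiff_const

lemma contDiff_col (j : Fin d) : ContDiff ℝ ∞ fun x : LinMap d m => col x j := by
  unfold col
  fun_prop

lemma contDiff_tangentProj (a : LinMap d m) : ContDiff ℝ ∞ (tangentProj a) := by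
  refine (contDiff_id (𝕜 := ℝ)).sub (ContDiff.const_smul (1 / 2 : ℝ) (contDiff_mulMat a fun i j => ?_))
  exact (contDiff_const.inner ℝ (contDiff_col j)).add ((contDiff_col i).inner ℝ contDiff_const)

lemma contDiff_straighten (a : LinMap d m) : ContDiff ℝ ∞ (straighten a) := by
  refine (contDiff_tangentProj a).add (ContDiff.const_smul (1 / 2 : ℝ) (contDiff_mulMat a fun i j => ?_))
  exact (contDiff_col i).inner ℝ (contDiff_col j)

lemma hasFDerivAt_straighten {a : LinMap d m} (ha : Orthonormal ℝ (col a)) :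
    HasFDerivAt (straighten a) (ContinuousLinearEquiv.refl ℝ (LinMap d m) : _ →L[ℝ] _) a := by
  have hfun : straighten a = fun x =>
      x - (1 / 2 : ℝ) • a + (1 / 2 : ℝ) • mulMat a (gram (x - a)) := funext (straighten_eq ha)
  rw [hfun]
  have hq : HasFDerivAt (fun x : LinMap d m => mulMat a (gram (x - a)))
      (0 : LinMap d m →L[ℝ] LinMap d m) a := by
    have h1 : HasFDerivAt (fun x : LinMap d m => mulMat a (gram x))
        (0 : LinMap d m →L[ℝ] LinMap d m) (0 : LinMap d m) := by
      have hs : Differentiable ℝ (fun x : LinMap d m => mulMat a (gram x)) :=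
        (contDiff_mulMat a fun i j => (contDiff_col i).inner ℝ (contDiff_col j)).differentiable
          (by simp)
      have h2 := (hs 0).hasFDerivAt
      convert h2 using 1
      symm
      -- an even function has vanishing derivative at the origin
      have heven : ∀ x : LinMap d m, mulMat a (gram (-x)) = mulMat a (gram x) := fun x => by
        congr 1
        ext i j
        simp [gram, col]
      have h3 := HasFDerivAt.comp (f := fun x : LinMap d m => -x) (0 : LinMap d m)
        (by rw [neg_zero]; exact h2) (hasFDerivAt_id (0 : LinMap d m)).neg
      have h4 : (fun x : LinMap d m => mulMat a (gram x)) ∘ (fun x => -x) =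
          fun x : LinMap d m => mulMat a (gram x) := funext heven
      rw [h4] at h3
      have h5 := h3.unique h2
      ext1 v
      have h6 := DFunLike.congr_fun h5 v
      simp at h6
      rw [zero_apply]
      have h7 : ∀ w : LinMap d m, -w = w → w = 0 := fun w hw => by
        ext x i
        have h8 := congrArg (fun z : LinMap d m => z x i) hw
        simp only [neg_apply, PiLp.neg_apply] at h8
        simp only [zero_apply, PiLp.zero_apply]
        linarith
      exact h7 _ h6
    have h2 := HasFDerivAt.comp (f := fun x : LinMap d m => x - a) a
      (by rw [sub_self]; exact h1) ((hasFDerivAt_id a).sub_const a)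
    simpa [comp_def] using h2
  have h := ((hasFDerivAt_id a).sub_const ((1 / 2 : ℝ) • a)).fun_add (hq.fun_const_smul (1 / 2 : ℝ))
  simpa using h

lemma Stiefel.orthonormal (a : Stiefel m d) : Orthonormal ℝ (col a.1) :=
  (isometry_iff_col a.1).1 a.2

/-- The local diffeomorphism of the space of all linear maps given by `straighten a`, on a
neighbourhood of `a` on which the derivative of `straighten a` is invertible. -/
def straightenHomeo (a : Stiefel m d) : OpenPartialHomeomorph (LinMap d m) (LinMap d m) :=
  ((contDiff_straighten a.1).contDiffAt.toOpenPartialHomeomorph (straighten a.1)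
    (hasFDerivAt_straighten a.orthonormal) (by simp)).restr
    {x | fderiv ℝ (straighten a.1) x ∈
      range ((↑) : (LinMap d m ≃L[ℝ] LinMap d m) → LinMap d m →L[ℝ] LinMap d m)}

lemma coe_straightenHomeo (a : Stiefel m d) : ⇑(straightenHomeo a) = straighten a.1 := rfl

lemma isOpen_invertible (a : Stiefel m d) : IsOpen {x | fderiv ℝ (straighten a.1) x ∈
    range ((↑) : (LinMap d m ≃L[ℝ] LinMap d m) → LinMap d m →L[ℝ] LinMap d m)} :=
  ContinuousLinearEquiv.isOpen.preimage ((contDiff_straighten a.1).continuous_fderiv (by simp))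

lemma mem_straightenHomeo_source (a : Stiefel m d) : a.1 ∈ (straightenHomeo a).source := by
  refine ⟨ContDiffAt.mem_toOpenPartialHomeomorph_source _ _ _, ?_⟩
  rw [(isOpen_invertible a).interior_eq]
  exact ⟨ContinuousLinearEquiv.refl ℝ _, (hasFDerivAt_straighten a.orthonormal).fderiv.symm⟩

lemma contDiffOn_straightenHomeo_symm (a : Stiefel m d) :
    ContDiffOn ℝ ∞ (straightenHomeo a).symm (straightenHomeo a).target := by
  intro y hy
  have h1 := ((straightenHomeo a).map_target hy).2
  rw [(isOpen_invertible a).interior_eq] at h1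
  obtain ⟨f', hf'⟩ := h1
  refine ContDiffAt.contDiffWithinAt
    ((straightenHomeo a).contDiffAt_symm (f₀' := f') hy ?_ (contDiff_straighten a.1).contDiffAt)
  rw [hf']
  exact ((contDiff_straighten a.1).differentiable (by simp) _).hasFDerivAt

/-- The model space of `V_{m,d}`, of dimension `m d - d (d + 1) / 2`. -/
abbrev StiefelModel (m d : ℕ) : Type := EuclideanSpace ℝ (Fin (m * d - (d + 1).choose 2))

/-- A linear isomorphism of the tangent space at `a` with the model space. -/
def tangentEquiv (a : Stiefel m d) : tangentAt a.1 ≃ₗ[ℝ] StiefelModel m d :=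
  haveI : Module.Free ℝ (tangentAt a.1) :=
    @Module.Free.of_divisionRing ℝ (tangentAt a.1) _ (Submodule.addCommGroup (tangentAt a.1)) _
  LinearEquiv.ofFinrankEq _ _ (by rw [finrank_tangentAt a.orthonormal, finrank_euclideanSpace_fin])

/-- The affine embedding of the model space as `T_a + a / 2`. -/
def tangentEmb (a : Stiefel m d) (y : StiefelModel m d) : LinMap d m :=
  ((tangentEquiv a).symm y : LinMap d m) + (1 / 2 : ℝ) • a.1

lemma contDiff_tangentEmb (a : Stiefel m d) : ContDiff ℝ ∞ (tangentEmb a) :=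
  (LinearMap.toContinuousLinearMap
    ((tangentAt a.1).subtype ∘ₗ (tangentEquiv a).symm.toLinearMap)).contDiff.add contDiff_const

/-- The coordinate map `V_{m,d} → T_a ≅ StiefelModel m d`, defined on all linear maps. -/
def coord (a : Stiefel m d) (x : LinMap d m) : StiefelModel m d :=
  tangentEquiv a ⟨tangentProj a.1 x, tangentProj_mem a.orthonormal x⟩

lemma contDiff_coord (a : Stiefel m d) : ContDiff ℝ ∞ (coord a) := by
  obtain ⟨Q, hQ⟩ := LinearMap.exists_extend (tangentEquiv a).toLinearMap
  have h : coord a = fun x => LinearMap.toContinuousLinearMap Q (tangentProj a.1 x) := by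
    ext1 x
    exact (LinearMap.congr_fun hQ ⟨tangentProj a.1 x, tangentProj_mem a.orthonormal x⟩).symm
  rw [h]
  exact (ContinuousLinearMap.contDiff _).comp (contDiff_tangentProj a.1)

lemma tangentEmb_coord (a x : Stiefel m d) : tangentEmb a (coord a x.1) = straighten a.1 x.1 := by
  rw [tangentEmb, coord, straighten_of_isometry _ x.orthonormal, 
    LinearEquiv.symm_apply_apply]

lemma orthonormal_of_tangentEmb (a : Stiefel m d) {y : StiefelModel m d}
    (hy : tangentEmb a y ∈ (straightenHomeo a).target) :
    Orthonormal ℝ (col ((straightenHomeo a).symm (tangentEmb a y))) := by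
  apply isometry_of_straighten a.orthonormal
  rw [← coe_straightenHomeo, (straightenHomeo a).right_inv hy, tangentEmb, add_sub_cancel_right]
  exact Subtype.property _

open Classical in
/-- The chart of `V_{m,d}` at `a`: the orthogonal projection to the tangent space at `a`. -/
def stiefelChart (a : Stiefel m d) : OpenPartialHomeomorph (Stiefel m d) (StiefelModel m d) where
  source := {x | x.1 ∈ (straightenHomeo a).source}
  target := {y | tangentEmb a y ∈ (straightenHomeo a).target}
  toFun x := coord a x.1
  invFun y :=
    if h : Orthonormal ℝ (col ((straightenHomeo a).symm (tangentEmb a y))) then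
      ⟨(straightenHomeo a).symm (tangentEmb a y), (isometry_iff_col _).2 h⟩ else a
  map_source' x hx := by
    change tangentEmb a (coord a x.1) ∈ (straightenHomeo a).target
    rw [tangentEmb_coord]
    exact (straightenHomeo a).map_source hx
  map_target' y hy := by
    simp only [dif_pos (orthonormal_of_tangentEmb a hy)]
    exact (straightenHomeo a).map_target hy
  left_inv' x hx := by
    have h : (straightenHomeo a).symm (tangentEmb a (coord a x.1)) = x.1 := by
      rw [tangentEmb_coord]
      exact (straightenHomeo a).left_inv hx
    have h' : Orthonormal ℝ (col ((straightenHomeo a).symm (tangentEmb a (coord a x.1)))) := by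
      rw [h]; exact x.orthonormal
    rw [dif_pos h']
    exact Stiefel.ext h
  right_inv' y hy := by
    simp only [dif_pos (orthonormal_of_tangentEmb a hy)]
    have h := tangentEmb_coord a ⟨_, (isometry_iff_col _).2 (orthonormal_of_tangentEmb a hy)⟩
    simp only at h
    rw [← coe_straightenHomeo, (straightenHomeo a).right_inv hy] at h
    simpa [tangentEmb] using h
  open_source := (straightenHomeo a).open_source.preimage continuous_stiefelVal
  open_target := (straightenHomeo a).open_target.preimage (contDiff_tangentEmb a).continuous
  continuousOn_toFun :=
    ((contDiff_coord a).continuous.comp continuous_stiefelVal).continuousOn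
  continuousOn_invFun := by
    have hind : Topology.IsInducing (Stiefel.val : Stiefel m d → LinMap d m) := ⟨rfl⟩
    rw [hind.continuousOn_iff]
    refine ((straightenHomeo a).continuousOn_symm.comp
      (contDiff_tangentEmb a).continuous.continuousOn fun y hy => hy).congr fun y hy => ?_
    simp only [comp_apply, dif_pos (orthonormal_of_tangentEmb a hy)]

lemma stiefelChart_apply (a x : Stiefel m d) : stiefelChart a x = coord a x.1 := rfl

lemma coe_stiefelChart_symm (a : Stiefel m d) {y : StiefelModel m d}
    (hy : y ∈ (stiefelChart a).target) :
    ((stiefelChart a).symm y).1 = (straightenHomeo a).symm (tangentEmb a y) := by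
  simp only [stiefelChart, OpenPartialHomeomorph.coe_mk_symm, PartialEquiv.coe_symm_mk]
  rw [dif_pos (orthonormal_of_tangentEmb a hy)]

/-- The inclusion of `V_{m,d}` in the space of all linear maps is smooth in the charts. -/
lemma contDiffOn_stiefelChart_symm (a : Stiefel m d) :
    ContDiffOn ℝ ∞ (fun y => ((stiefelChart a).symm y).1) (stiefelChart a).target :=
  ((contDiffOn_straightenHomeo_symm a).comp (contDiff_tangentEmb a).contDiffOn
    fun _ hy => hy).congr fun _ hy => coe_stiefelChart_symm a hy

instance : ChartedSpace (StiefelModel m d) (Stiefel m d) where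
  atlas := range stiefelChart
  chartAt := stiefelChart
  mem_chart_source a := mem_straightenHomeo_source a
  chart_mem_atlas a := mem_range_self a

instance : IsManifold 𝓘(ℝ, StiefelModel m d) ∞ (Stiefel m d) := by
  refine isManifold_of_contDiffOn _ _ _ ?_
  rintro _ _ ⟨a, rfl⟩ ⟨b, rfl⟩
  simp only [modelWithCornersSelf_coe, modelWithCornersSelf_coe_symm, id_comp, comp_id, preimage_id,
    range_id, inter_univ]
  exact ((contDiff_coord b).comp_contDiffOn (contDiffOn_stiefelChart_symm a)).mono fun y hy => hy.1

end Spaces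

end StiefelForms

end

open StiefelForms

noncomputable section

namespace StiefelForms

/-! ### Smoothness of the pullback of an alternating form in the form and the linear map -/

section Calculus

variable {E : Type*} [NormedAddCommGroup E] [NormedSpace ℝ E]
  {F : Type*} [NormedAddCommGroup F] [NormedSpace ℝ F]
  {G : Type*} [NormedAddCommGroup G] [NormedSpace ℝ G]

/-! Gram–Schmidt fixes orthonormal families, so `Λ ∘ ι = id` (`gramSchmidtMap_comp_incl`).
Conversely `ι ∘ Λ` is joined to the identity by the straight-line homotopy. Write `e_k` for the
orthonormalized columns of `α`. The matrix `⟪e_k, α e_j⟫` is upper triangular with positive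
diagonal, hence so is its convex combination with the identity matrix; the homotopy therefore never
leaves `Inj d m` (`homotopy_injective`).

The homotopy formula is Cartan's formula for `∂_t`, integrated over `[0,1]`. Contraction with `∂_t`
anticommutes with the part of `d` that differentiates along the base, so only the `t`-derivative
survives (`contractCLM_alternatizeUncurryFin`), and the fundamental theorem of calculus evaluates
its integral as the difference of the two ends (`intervalFibreIntegral_extDeriv_add`). Applied to
the pulled-back form, the ends are `θ` at `t = 0` and `Λ^* ι^* θ` at `t = 1`. On a closed form the
formula exhibits this difference as exact, or as zero in degree `0`; the two pullbacks are thus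
inverse on cohomology (`exists_cohomology_equiv`). Gram–Schmidt commutes with isometries of `ℝ^m`,
so the homotopy is `SO(m)`-equivariant and the operator preserves invariant forms; the same argument
then covers invariant cohomology.

The analysis takes place in normed spaces. `Inj d m` is open in `LinMap d m`, so its forms are
functions (`flat`), and `[0,1]` is replaced by an open set of real times (`homotopyDomain`), which
avoids the boundary. `fibreIntegral_pullbackField_homotopy` translates back to the fibre integral on
`Inj d m × [0,1]`. The charts of the Stiefel manifold enter only through the smoothness of `ι`, of
`Λ` and of the action. -/

lemma norm_alternatization_le {p : ℕ}
    (f : ContinuousMultilinearMap ℝ (fun _ : Fin p => E) ℝ) :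
    ‖ContinuousMultilinearMap.alternatization f‖ ≤ (p.factorial : ℝ) * ‖f‖ := by
  refine ContinuousAlternatingMap.opNorm_le_bound _ (by positivity) fun v => ?_
  rw [ContinuousMultilinearMap.alternatization_apply_apply]
  refine (norm_sum_le _ _).trans ?_
  have h : ∀ σ ∈ (Finset.univ : Finset (Equiv.Perm (Fin p))),
      ‖Equiv.Perm.sign σ • f (v ∘ σ)‖ ≤ ‖f‖ * ∏ i, ‖v i‖ := fun σ _ => by
    have h1 : ‖Equiv.Perm.sign σ • f (v ∘ σ)‖ = ‖f (v ∘ σ)‖ := by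
      rcases Int.units_eq_one_or (Equiv.Perm.sign σ) with h | h <;> simp [h]
    rw [h1]
    refine (f.le_opNorm _).trans_eq ?_
    congr 1
    exact Equiv.prod_comp σ fun i => ‖v i‖
  refine (Finset.sum_le_card_nsmul _ _ _ h).trans_eq ?_
  rw [Finset.card_univ, Fintype.card_perm, Fintype.card_fin, nsmul_eq_mul, mul_assoc]

/-- Alternatization as a continuous linear map. -/
def alternatizationCLM (E : Type*) [NormedAddCommGroup E] [NormedSpace ℝ E] (p : ℕ) :
    ContinuousMultilinearMap ℝ (fun _ : Fin p => E) ℝ →L[ℝ] E [⋀^Fin p]→L[ℝ] ℝ :=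
  (ContinuousMultilinearMap.alternatization (R := ℝ) (M := E) (N := ℝ) (ι := Fin p)).toRealLinearMap
    (AddMonoidHomClass.continuous_of_bound _ _ norm_alternatization_le)

/-- On an alternating form each permutation contributes its sign twice, so all `p!` summands agree.
Dividing by `p!` thus gives a continuous linear left inverse of the inclusion of alternating forms
in multilinear maps. -/
lemma alternatizationCLM_toContinuousMultilinearMap {p : ℕ} (f : E [⋀^Fin p]→L[ℝ] ℝ) :
    alternatizationCLM E p f.toContinuousMultilinearMap = (p.factorial : ℝ) • f := by
  ext v
  change ContinuousMultilinearMap.alternatization f.toContinuousMultilinearMap v = _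
  rw [ContinuousMultilinearMap.alternatization_apply_apply]
  have h : ∀ σ : Equiv.Perm (Fin p), Equiv.Perm.sign σ • f (v ∘ σ) = f v := fun σ => by
    have h1 : f (v ∘ σ) = Equiv.Perm.sign σ • f v := f.toAlternatingMap.map_perm v σ
    rw [h1, smul_smul, Int.units_mul_self, one_smul]
  change ∑ σ : Equiv.Perm (Fin p), Equiv.Perm.sign σ • f (v ∘ σ) = _
  rw [Finset.sum_congr rfl fun σ _ => h σ]
  simp [Fintype.card_perm]

/-- The pullback is linear in the form and polynomial of degree `p` in the linear map. For
multilinear maps this dependence is a continuous multilinear map; alternatization divided by `p!`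
carries its smoothness over to alternating forms. -/
lemma contDiff_compContinuousLinearMap {p : ℕ} {n : ℕ∞} :
    ContDiff ℝ n fun q : (F [⋀^Fin p]→L[ℝ] ℝ) × (E →L[ℝ] F) =>
      q.1.compContinuousLinearMap q.2 := by
  have h : (fun q : (F [⋀^Fin p]→L[ℝ] ℝ) × (E →L[ℝ] F) => q.1.compContinuousLinearMap q.2) =
      fun q => (p.factorial : ℝ)⁻¹ • alternatizationCLM E p
        (ContinuousMultilinearMap.compContinuousLinearMapContinuousMultilinear ℝ
          (fun _ : Fin p => E) (fun _ : Fin p => F) ℝ (fun _ => q.2)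
          (ContinuousAlternatingMap.toContinuousMultilinearMapCLM ℝ q.1)) := by
    ext1 q
    have := alternatizationCLM_toContinuousMultilinearMap (q.1.compContinuousLinearMap q.2)
    rw [eq_inv_smul_iff₀ (by positivity), ← this]
    rfl
  rw [h]
  refine ContDiff.const_smul _ ((alternatizationCLM E p).contDiff.comp (ContDiff.clm_apply ?_ ?_))
  · exact (ContinuousMultilinearMap.contDiff _).comp (contDiff_pi.2 fun _ => contDiff_snd)
  · exact (ContinuousLinearMap.contDiff _).comp contDiff_fst

lemma ContDiffOn.compContinuousLinearMap {p : ℕ} {n : ℕ∞} {s : Set G}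
    {f : G → F [⋀^Fin p]→L[ℝ] ℝ} {g : G → E →L[ℝ] F} (hf : ContDiffOn ℝ n f s)
    (hg : ContDiffOn ℝ n g s) :
    ContDiffOn ℝ n (fun x => (f x).compContinuousLinearMap (g x)) s :=
  contDiff_compContinuousLinearMap.comp_contDiffOn (hf.prodMk hg)

end Calculus

/-! ### Functoriality of pullback and its compatibility with the exterior derivative -/

section Pullback

variable {E : Type*} [NormedAddCommGroup E] [NormedSpace ℝ E]
  {M : Type*} [TopologicalSpace M] [ChartedSpace E M]
  {E' : Type*} [NormedAddCommGroup E'] [NormedSpace ℝ E']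
  {N : Type*} [TopologicalSpace N] [ChartedSpace E' N]
  {E'' : Type*} [NormedAddCommGroup E''] [NormedSpace ℝ E'']
  {P : Type*} [TopologicalSpace P] [ChartedSpace E'' P]

lemma pull_comp {g : N → P} {f : M → N} (hg : MDifferentiable 𝓘(ℝ, E') 𝓘(ℝ, E'') g)
    (hf : MDifferentiable 𝓘(ℝ, E) 𝓘(ℝ, E') f) {p : ℕ} (θ : FormField E'' P p) :
    pull (E := E) (E' := E'') (g ∘ f) θ = pull (E := E) (E' := E') f (pull (E' := E'') g θ) := by
  ext x v
  simp only [pullbackField, differentialAt, mfderiv_comp x (hg (f x)) (hf x)]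
  rfl

lemma pull_id {p : ℕ} (θ : FormField E M p) : pull (id : M → M) θ = θ := by
  ext x v
  simp only [pullbackField, differentialAt, mfderiv_id]
  rfl

lemma pull_add {p : ℕ} (f : M → N) (θ η : FormField E' N p) :
    pull (E := E) f (θ + η) = pull f θ + pull f η := by
  ext x v; simp [pullbackField]

lemma pull_smul {p : ℕ} (f : M → N) (c : ℝ) (θ : FormField E' N p) :
    pull (E := E) f (c • θ) = c • pull f θ := by
  ext x v; simp [pullbackField]

/-- The expression of a map in the charts at `x` and `y`. -/
def chartRep (E : Type*) [NormedAddCommGroup E] [NormedSpace ℝ E] {M : Type*} [TopologicalSpace M]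
    [ChartedSpace E M] (E' : Type*) [NormedAddCommGroup E'] [NormedSpace ℝ E'] {N : Type*}
    [TopologicalSpace N] [ChartedSpace E' N] (f : M → N) (x : M) (y : N) : E → E' :=
  chartAt E' y ∘ f ∘ (chartAt E x).symm

/-- The domain of the expression of a map in the charts at `x` and `y`. -/
def chartDom (E : Type*) [NormedAddCommGroup E] [NormedSpace ℝ E] {M : Type*} [TopologicalSpace M]
    [ChartedSpace E M] (E' : Type*) [NormedAddCommGroup E'] [NormedSpace ℝ E'] {N : Type*}
    [TopologicalSpace N] [ChartedSpace E' N] (f : M → N) (x : M) (y : N) : Set E :=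
  (chartAt E x).target ∩ (chartAt E x).symm ⁻¹' (f ⁻¹' (chartAt E' y).source)

lemma isOpen_chartDom {f : M → N} (hf : Continuous f) (x : M) (y : N) :
    IsOpen (chartDom E E' f x y) :=
  (chartAt E x).continuousOn_symm.isOpen_inter_preimage (chartAt E x).open_target
    ((chartAt E' y).open_source.preimage hf)

lemma mapsTo_chartRep (f : M → N) (x : M) (y : N) :
    MapsTo (chartRep E E' f x y) (chartDom E E' f x y) (chartAt E' y).target :=
  fun _ hz => (chartAt E' y).map_source hz.2

variable [IsManifold 𝓘(ℝ, E) ∞ M] [IsManifold 𝓘(ℝ, E') ∞ N]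

lemma contDiffOn_chartRep {f : M → N} (hf : ContMDiff 𝓘(ℝ, E) 𝓘(ℝ, E') ∞ f) (x : M) (y : N) :
    ContDiffOn ℝ ∞ (chartRep E E' f x y) (chartDom E E' f x y) := by
  refine contMDiffOn_iff_contDiffOn.1 ?_
  refine (contMDiffOn_chart (I := 𝓘(ℝ, E')) (n := ∞) (x := y)).comp
    (t := (chartAt E' y).source) (hf.comp_contMDiffOn
      ((contMDiffOn_chart_symm (I := 𝓘(ℝ, E)) (n := ∞) (x := x)).mono inter_subset_left)) ?_
  intro z hz
  exact hz.2

/-- The chain rule, with the derivatives of the chart at `y` and of its inverse cancelling. It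
reduces statements about `f^*` to pullback between open subsets of normed spaces. -/
lemma localRep_pull {f : M → N} (hf : ContMDiff 𝓘(ℝ, E) 𝓘(ℝ, E') ∞ f) {p : ℕ}
    (θ : FormField E' N p) (x : M) (y : N) {z : E} (hz : z ∈ chartDom E E' f x y) :
    localRep x (pull (E := E) f θ) z =
      (localRep y θ (chartRep E E' f x y z)).compContinuousLinearMap
        (fderiv ℝ (chartRep E E' f x y) z) := by
  set e₀ := chartAt E x with he₀
  set e := chartAt E' y with he
  have hE₀ : e₀.MDifferentiable 𝓘(ℝ, E) 𝓘(ℝ, E) := mdifferentiable_chart x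
  have hE : e.MDifferentiable 𝓘(ℝ, E') 𝓘(ℝ, E') := mdifferentiable_chart y
  have hz2 : f (e₀.symm z) ∈ e.source := hz.2
  have h1 := hE₀.mdifferentiableAt_symm hz.1
  have h2 := hE.mdifferentiableAt hz2
  have h3 : MDifferentiableAt 𝓘(ℝ, E) 𝓘(ℝ, E') f (e₀.symm z) := hf.mdifferentiable (by simp) _
  have h4 : mfderiv 𝓘(ℝ, E) 𝓘(ℝ, E') (e ∘ (f ∘ e₀.symm)) z = _ :=
    mfderiv_comp z h2 (h3.comp z h1)
  have h4' : mfderiv 𝓘(ℝ, E) 𝓘(ℝ, E') (f ∘ e₀.symm) z = _ := mfderiv_comp z h3 h1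
  have h5 := hE.symm_comp_deriv hz2
  have h6 : fderiv ℝ (chartRep E E' f x y) z = _ := mfderiv_eq_fderiv.symm.trans h4
  rw [h6, h4']
  ext v
  change θ (f (e₀.symm z)) (fun i => mfderiv 𝓘(ℝ, E) 𝓘(ℝ, E') f (e₀.symm z)
      (mfderiv 𝓘(ℝ, E) 𝓘(ℝ, E) e₀.symm z (v i))) =
    θ (e.symm (e (f (e₀.symm z)))) (fun i => mfderiv 𝓘(ℝ, E') 𝓘(ℝ, E') e.symm (e (f (e₀.symm z)))
      (mfderiv 𝓘(ℝ, E') 𝓘(ℝ, E') e (f (e₀.symm z)) (mfderiv 𝓘(ℝ, E) 𝓘(ℝ, E') f (e₀.symm z)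
        (mfderiv 𝓘(ℝ, E) 𝓘(ℝ, E) e₀.symm z (v i)))))
  rw [e.left_inv hz2]
  congr 1
  ext i
  exact (DFunLike.congr_fun h5 _).symm

/-- Pullbacks of smooth forms along smooth maps are smooth. -/
lemma IsSmoothForm.pull {f : M → N} (hf : ContMDiff 𝓘(ℝ, E) 𝓘(ℝ, E') ∞ f) {p : ℕ}
    {θ : FormField E' N p} (hθ : IsSmoothForm θ) :
    IsSmoothForm (StiefelForms.pull (E := E) f θ) := by
  intro x z hz
  -- The target chart is chosen anew for each `z`, since the image under `f` of one chart domain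
  -- need not lie in one chart domain.
  set y := f ((chartAt E x).symm z)
  have hzd : z ∈ chartDom E E' f x y := ⟨hz, mem_chart_source E' y⟩
  have hopen := isOpen_chartDom (E := E) (E' := E') hf.continuous x y
  have h1 := contDiffOn_chartRep hf x y
  have h2 : ContDiffOn ℝ ∞ (fun z => (localRep y θ (chartRep E E' f x y z)).compContinuousLinearMap
      (fderiv ℝ (chartRep E E' f x y) z)) (chartDom E E' f x y) :=
    ContDiffOn.compContinuousLinearMap ((hθ y).comp h1 (mapsTo_chartRep f x y))
      (h1.fderiv_of_isOpen hopen (by simp))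
  have h3 := h2.congr fun z hz => localRep_pull hf θ x y hz
  exact (h3.contDiffAt (hopen.mem_nhds hzd)).contDiffWithinAt

/-- The exterior derivative commutes with pullbacks. -/
lemma extDerivField_pull {f : M → N} (hf : ContMDiff 𝓘(ℝ, E) 𝓘(ℝ, E') ∞ f) {p : ℕ}
    {θ : FormField E' N p} (hθ : IsSmoothForm θ) :
    extDerivField (pull (E := E) f θ) = pull (E := E) f (extDerivField θ) := by
  ext1 x
  set y := f x
  set z := chartAt E x x with hz
  have hzs : (chartAt E x).symm z = x := (chartAt E x).left_inv (mem_chart_source E x)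
  have hzd : z ∈ chartDom E E' f x y := by
    refine ⟨mem_chart_target E x, ?_⟩
    simp only [mem_preimage, hzs]
    exact mem_chart_source E' y
  have hopen := isOpen_chartDom (E := E) (E' := E') hf.continuous x y
  have hnhds := hopen.mem_nhds hzd
  have h1 := (contDiffOn_chartRep hf x y).contDiffAt hnhds
  have hrep : localRep x (pull (E := E) f θ) =ᶠ[𝓝 z] fun z =>
      (localRep y θ (chartRep E E' f x y z)).compContinuousLinearMap
        (fderiv ℝ (chartRep E E' f x y) z) := by
    filter_upwards [hnhds] with w hw using localRep_pull hf θ x y hw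
  have key : localRep x (extDerivField (pull (E := E) f θ)) z =
      localRep x (pull (E := E) f (extDerivField θ)) z := by
    rw [localRep_extDerivField (hθ.pull hf) x hzd.1, hrep.extDeriv_eq,
      extDeriv_pullback (r := ∞) (hθ.differentiableAt y (mapsTo_chartRep f x y hzd)) h1
        (by simp only [minSmoothness_of_isRCLikeNormedField]
            exact WithTop.coe_le_coe.2 (le_top : (2 : ℕ∞) ≤ ⊤)),
      localRep_pull hf _ x y hzd, localRep_extDerivField hθ y (mapsTo_chartRep f x y hzd)]
  -- A form at `x` is recovered from its coordinate expression at the image of `x`, so it suffices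
  -- to compare coordinate expressions there.
  have hinj : ∀ η : FormField E M (p + 1), η x =
      (localRep x η z).compContinuousLinearMap (differentialAt 𝓘(ℝ, E) 𝓘(ℝ, E) (chartAt E x) x) := by
    intro η
    ext v
    have h5 := (mdifferentiable_chart (I := 𝓘(ℝ, E)) x).symm_comp_deriv (mem_chart_source E x)
    change η x v = η ((chartAt E x).symm z) (fun i =>
      mfderiv 𝓘(ℝ, E) 𝓘(ℝ, E) (chartAt E x).symm z
        (mfderiv 𝓘(ℝ, E) 𝓘(ℝ, E) (chartAt E x) x (v i)))
    rw [hzs]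
    congr 1
    ext i
    exact (DFunLike.congr_fun h5 (v i)).symm
  rw [hinj (extDerivField _), key, ← hinj]

/-- The pullback of smooth forms along a smooth map, as a linear map. -/
def pullForm {f : M → N} (hf : ContMDiff 𝓘(ℝ, E) 𝓘(ℝ, E') ∞ f) (p : ℕ) :
    DiffForm E' N p →ₗ[ℝ] DiffForm E M p where
  toFun θ := ⟨pull f θ.field, θ.smooth.pull hf⟩
  map_add' θ η := DiffForm.ext (pull_add f θ.field η.field)
  map_smul' c θ := DiffForm.ext (pull_smul f c θ.field)

@[simp] lemma field_pullForm {f : M → N} (hf : ContMDiff 𝓘(ℝ, E) 𝓘(ℝ, E') ∞ f) {p : ℕ}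
    (θ : DiffForm E' N p) : (pullForm hf p θ).field = pull f θ.field := rfl

lemma extD_pullForm {f : M → N} (hf : ContMDiff 𝓘(ℝ, E) 𝓘(ℝ, E') ∞ f) {p : ℕ}
    (θ : DiffForm E' N p) :
    extD E M p (pullForm hf p θ) = pullForm hf (p + 1) (extD E' N p θ) :=
  DiffForm.ext (extDerivField_pull hf θ.smooth)

/-- The pullback along an equivariant map preserves invariant forms. -/
lemma pullForm_mem_invariantForms {Γ : Type*} [Group Γ] [MulAction Γ M] [MulAction Γ N] {f : M → N}
    (hf : ContMDiff 𝓘(ℝ, E) 𝓘(ℝ, E') ∞ f) (hequiv : ∀ (g : Γ) (x : M), f (g • x) = g • f x)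
    (hM : ∀ g : Γ, MDifferentiable 𝓘(ℝ, E) 𝓘(ℝ, E) (g • · : M → M))
    (hN : ∀ g : Γ, MDifferentiable 𝓘(ℝ, E') 𝓘(ℝ, E') (g • · : N → N)) {p : ℕ}
    {θ : DiffForm E' N p} (hθ : θ ∈ invariantForms E' N Γ p) :
    pullForm hf p θ ∈ invariantForms E M Γ p := by
  intro g
  have hfd := hf.mdifferentiable (by simp)
  have h : f ∘ (g • · : M → M) = (g • · : N → N) ∘ f := funext (hequiv g)
  rw [field_pullForm, ← pull_comp hfd (hM g), h, pull_comp (hN g) hfd, hθ g]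

end Pullback

/-! ### Pullback on cohomology and the algebra of homotopy operators -/

section Cohomology

variable {E : Type*} [NormedAddCommGroup E] [NormedSpace ℝ E]
  {M : Type*} [TopologicalSpace M] [ChartedSpace E M]
  {E' : Type*} [NormedAddCommGroup E'] [NormedSpace ℝ E']
  {N : Type*} [TopologicalSpace N] [ChartedSpace E' N]
  [IsManifold 𝓘(ℝ, E) ∞ M] [IsManifold 𝓘(ℝ, E') ∞ N]
  {S : ∀ p, Submodule ℝ (DiffForm E M p)} {T : ∀ p, Submodule ℝ (DiffForm E' N p)}

/-- The pullback on closed forms. -/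
def pullCocycles {f : M → N} (hf : ContMDiff 𝓘(ℝ, E) 𝓘(ℝ, E') ∞ f)
    (hST : ∀ p, ∀ θ ∈ T p, pullForm hf p θ ∈ S p) (p : ℕ) : cocycles T p →ₗ[ℝ] cocycles S p :=
  (pullForm hf p).restrict fun θ hθ => ⟨hST p θ hθ.1, by
    have h : extD E' N p θ = 0 := hθ.2
    change extD E M p (pullForm hf p θ) = 0
    rw [extD_pullForm, h, map_zero]⟩

/-- The pullback on cohomology. -/
def pullCohomology {f : M → N} (hf : ContMDiff 𝓘(ℝ, E) 𝓘(ℝ, E') ∞ f)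
    (hST : ∀ p, ∀ θ ∈ T p, pullForm hf p θ ∈ S p) (p : ℕ) :
    Cohomology T p →ₗ[ℝ] Cohomology S p :=
  Submodule.mapQ _ _ (pullCocycles hf hST p) fun θ hθ => by
    change pullForm hf p θ.1 ∈ coboundaries S p
    change θ.1 ∈ coboundaries T p at hθ
    cases p with
    | zero =>
      have h : θ.1 = 0 := hθ
      change pullForm hf 0 θ.1 = 0
      rw [h, map_zero]
    | succ p =>
      obtain ⟨η, hη, h⟩ := hθ
      exact ⟨pullForm hf p η, hST p η hη, by rw [extD_pullForm, h]⟩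

lemma isInducedByPullback_pullCohomology {f : M → N} (hf : ContMDiff 𝓘(ℝ, E) 𝓘(ℝ, E') ∞ f)
    (hST : ∀ p, ∀ θ ∈ T p, pullForm hf p θ ∈ S p) (p : ℕ) :
    IsInducedByPullback f (pullCohomology hf hST p) :=
  fun θ => ⟨pullCocycles hf hST p θ, rfl, rfl⟩

/-- A retraction `g` onto `M` together with a homotopy operator for `f ∘ g` induces inverse
isomorphisms in cohomology. -/
theorem exists_cohomology_equiv {f : M → N} {g : N → M} (hf : ContMDiff 𝓘(ℝ, E) 𝓘(ℝ, E') ∞ f)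
    (hg : ContMDiff 𝓘(ℝ, E') 𝓘(ℝ, E) ∞ g) (hgf : g ∘ f = id)
    (hST : ∀ p, ∀ θ ∈ T p, pullForm hf p θ ∈ S p) (hTS : ∀ p, ∀ θ ∈ S p, pullForm hg p θ ∈ T p)
    (K : ∀ p, DiffForm E' N (p + 1) →ₗ[ℝ] DiffForm E' N p)
    (hK : ∀ p, ∀ θ ∈ T (p + 1), K p θ ∈ T p)
    (h0 : ∀ θ : DiffForm E' N 0, pullForm hg 0 (pullForm hf 0 θ) - θ = K 0 (extD E' N 0 θ))
    (hs : ∀ (p : ℕ) (θ : DiffForm E' N (p + 1)), pullForm hg (p + 1) (pullForm hf (p + 1) θ) - θ =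
      K (p + 1) (extD E' N (p + 1) θ) + extD E' N p (K p θ)) (p : ℕ) :
    ∃ e : Cohomology T p ≃ₗ[ℝ] Cohomology S p,
      IsInducedByPullback f e.toLinearMap ∧ IsInducedByPullback g e.symm.toLinearMap := by
  refine ⟨LinearEquiv.ofLinearMap (pullCohomology hf hST p) (pullCohomology hg hTS p) ?_ ?_,
    isInducedByPullback_pullCohomology hf hST p, isInducedByPullback_pullCohomology hg hTS p⟩
  -- This composite is the identity already on forms, because `g ∘ f = id`.
  · ext θ
    refine congrArg Submodule.Quotient.mk (Subtype.ext (DiffForm.ext ?_))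
    change pull f (pull g θ.1.field) = θ.1.field
    rw [← pull_comp (hg.mdifferentiable (by simp)) (hf.mdifferentiable (by simp)), hgf, pull_id]
  -- On a closed form the term `K (d θ)` vanishes. What is left is `d (K θ)`, with `K θ` again in
  -- the family; in degree `0` nothing is left, in agreement with `coboundaries` being `⊥` there.
  · ext θ
    refine (Submodule.Quotient.eq _).2 ?_
    change pullForm hg p (pullForm hf p θ.1) - θ.1 ∈ coboundaries T p
    have hd : extD E' N p θ.1 = 0 := θ.2.2
    cases p with
    | zero =>
      rw [h0, hd, map_zero]
      exact Submodule.zero_mem _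
    | succ p =>
      rw [hs, hd, map_zero, zero_add]
      exact ⟨K p θ.1, hK p _ θ.2.1, rfl⟩

end Cohomology

end StiefelForms

namespace StiefelForms

/-! ### Forms on an open subset of a normed space -/

section OpensChart

open TopologicalSpace

variable {E : Type*} [TopologicalSpace E] {U : Opens E}

lemma coe_chartAt_opens (x : U) : ⇑(chartAt E x) = (Subtype.val : U → E) := rfl

lemma target_chartAt_opens (x : U) : (chartAt E x).target = U := by
  ext y
  constructor
  · intro hy
    rw [← (chartAt E x).right_inv hy]
    exact ((chartAt E x).symm y).2
  · intro hy
    exact (chartAt E x).map_source (x := ⟨y, hy⟩) (by simp [Opens.chartAt_eq, chartAt_self_eq])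

lemma chartAt_opens_symm (x : U) {y : E} (hy : y ∈ U) : (chartAt E x).symm y = ⟨y, hy⟩ :=
  Subtype.ext ((chartAt E x).right_inv (by rw [target_chartAt_opens]; exact hy))

end OpensChart

section Opens

open TopologicalSpace

variable {E : Type*} [NormedAddCommGroup E] [NormedSpace ℝ E] {U : Opens E}

/-- The inclusion is the chart at `x`, and the tangent space at `x` is read in that same chart, so
the differential is the coordinate change from a chart to itself. -/
lemma mfderiv_subtypeVal_opens (x : U) :
    mfderiv 𝓘(ℝ, E) 𝓘(ℝ, E) (Subtype.val : U → E) x = ContinuousLinearMap.id ℝ E := by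
  have h1 := mfderiv_chartAt_eq_tangentCoordChange (I := 𝓘(ℝ, E)) (mem_chart_source E x)
  rw [coe_chartAt_opens] at h1
  rw [h1]
  ext v
  exact tangentCoordChange_self (mem_extChartAt_source x)

lemma mfderiv_chartAt_opens_symm (x : U) {y : E} (hy : y ∈ U) :
    mfderiv 𝓘(ℝ, E) 𝓘(ℝ, E) (chartAt E x).symm y = ContinuousLinearMap.id ℝ E := by
  have hy' : y ∈ (chartAt E x).target := by rw [target_chartAt_opens]; exact hy
  have h := (mdifferentiable_chart (I := 𝓘(ℝ, E)) x).comp_symm_deriv hy'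
  have h2 := mfderiv_subtypeVal_opens ((chartAt E x).symm y)
  rw [coe_chartAt_opens, h2] at h
  exact h

/-- The extension by zero of a field of forms on an open subset of a normed space. -/
def flat {p : ℕ} (θ : FormField E U p) : E → E [⋀^Fin p]→L[ℝ] ℝ :=
  open Classical in fun y => if h : y ∈ U then θ ⟨y, h⟩ else 0

lemma flat_of_mem {p : ℕ} (θ : FormField E U p) {y : E} (hy : y ∈ U) : flat θ y = θ ⟨y, hy⟩ :=
  dif_pos hy

@[simp] lemma flat_coe {p : ℕ} (θ : FormField E U p) (x : U) : flat θ x = θ x :=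
  flat_of_mem θ x.2

/-- Every chart of `U` is the inclusion, with identity differential. The single function `flat θ`
therefore serves as coordinate expression at all points, and smoothness and `d` become those of a
function on `E`. -/
lemma localRep_opens (x : U) {p : ℕ} (θ : FormField E U p) :
    EqOn (localRep x θ) (flat θ) U := by
  intro y hy
  ext v
  simp only [localRep, pullbackField, differentialAt, mfderiv_chartAt_opens_symm x hy,
    chartAt_opens_symm x hy, flat_of_mem θ hy]
  rfl

lemma isSmoothForm_opens_iff {p : ℕ} {θ : FormField E U p} :
    IsSmoothForm θ ↔ ContDiffOn ℝ ∞ (flat θ) U := by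
  constructor
  · intro h y hy
    have h1 := h ⟨y, hy⟩
    rw [target_chartAt_opens] at h1
    exact (h1.congr fun z hz => (localRep_opens _ θ hz).symm) y hy
  · intro h x
    rw [target_chartAt_opens]
    exact h.congr (localRep_opens x θ)

lemma extDerivField_opens {p : ℕ} (θ : FormField E U p) (x : U) :
    extDerivField θ x = extDeriv (flat θ) x := by
  have h : localRep x θ =ᶠ[𝓝 (x : E)] flat θ := by
    filter_upwards [U.2.mem_nhds x.2] with y hy using localRep_opens x θ hy
  ext v
  simp only [extDerivField, differentialAt, coe_chartAt_opens, mfderiv_subtypeVal_opens,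
    h.extDeriv_eq]
  rfl

end Opens

end StiefelForms

namespace StiefelForms

/-! ### Integrals over the unit interval depending on a parameter -/

section ParametricIntegral

open MeasureTheory

lemma continuous_slice {E F : Type*} [TopologicalSpace E] [TopologicalSpace F] {W : Set (E × ℝ)}
    {f : E × ℝ → F} (hf : ContinuousOn f W) {a : E} (ha : ∀ t ∈ Icc (0 : ℝ) 1, (a, t) ∈ W) :
    Continuous fun t : Icc (0 : ℝ) 1 => f (a, t) :=
  hf.comp_continuous (by fun_prop) fun t => ha t t.2

lemma integrable_slice {E F : Type*} [TopologicalSpace E] [NormedAddCommGroup F]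
    {W : Set (E × ℝ)} {f : E × ℝ → F} (hf : ContinuousOn f W) {a : E}
    (ha : ∀ t ∈ Icc (0 : ℝ) 1, (a, t) ∈ W) :
    Integrable fun t : Icc (0 : ℝ) 1 => f (a, t) :=
  (continuous_slice hf ha).integrable_of_hasCompactSupport (HasCompactSupport.of_compactSpace _)

universe u

variable {E : Type u} [NormedAddCommGroup E] [NormedSpace ℝ E]
  {F : Type u} [NormedAddCommGroup F] [NormedSpace ℝ F]
  {U : Set E} {W : Set (E × ℝ)} {f : E × ℝ → F}

/-- Differentiation under the integral sign over the unit interval. -/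
lemma hasFDerivAt_integral_slice (hU : IsOpen U) (hW : IsOpen W)
    (hUW : ∀ a ∈ U, ∀ t ∈ Icc (0 : ℝ) 1, (a, t) ∈ W) (hf : ContDiffOn ℝ 1 f W) {a : E}
    (ha : a ∈ U) :
    HasFDerivAt (fun x => ∫ t : Icc (0 : ℝ) 1, f (x, t))
      (∫ t : Icc (0 : ℝ) 1, (fderiv ℝ f (a, t)).comp (ContinuousLinearMap.inl ℝ E ℝ)) a := by
  have hdf : ContinuousOn (fderiv ℝ f) W := hf.continuousOn_fderiv_of_isOpen hW (by simp)
  have hg : ContinuousOn (fun q => (fderiv ℝ f q).comp (ContinuousLinearMap.inl ℝ E ℝ)) W :=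
    hdf.clm_comp continuousOn_const
  obtain ⟨C, hC⟩ := (isCompact_singleton.prod isCompact_Icc :
    IsCompact (({a} : Set E) ×ˢ Icc (0 : ℝ) 1)).exists_bound_of_continuousOn
      (hg.mono (by rintro ⟨x, t⟩ ⟨rfl, ht⟩; exact hUW _ ha t ht))
  have hopen : IsOpen (W ∩ (fun q => ‖(fderiv ℝ f q).comp (ContinuousLinearMap.inl ℝ E ℝ)‖) ⁻¹'
      Iio (C + 1)) := hg.norm.isOpen_inter_preimage hW isOpen_Iio
  -- The derivative is bounded by `C` on the compact slice over `a`. By the tube lemma the bound `C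
  -- + 1` holds over a whole neighbourhood `u` of `a`, which gives the constant dominating function.
  obtain ⟨u, v, hu, -, hau, htv, huv⟩ := generalized_tube_lemma isCompact_singleton
    isCompact_Icc hopen (s := ({a} : Set E)) (t := Icc (0 : ℝ) 1) (by
      rintro ⟨x, t⟩ ⟨hx, ht⟩
      have hx' : x = a := hx
      subst hx'
      exact ⟨hUW _ ha t ht, (hC (x, t) ⟨rfl, ht⟩).trans_lt (lt_add_one C)⟩)
  refine hasFDerivAt_integral_of_dominated_of_fderiv_le
    (F' := fun x (t : Icc (0 : ℝ) 1) => (fderiv ℝ f (x, t)).comp (ContinuousLinearMap.inl ℝ E ℝ))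
    (s := u) (bound := fun _ => C + 1) (hu.mem_nhds (hau rfl)) ?_
    (integrable_slice hf.continuousOn (hUW a ha)) (integrable_slice hg (hUW a ha)).1 ?_
    (integrable_const _) ?_
  · filter_upwards [hU.mem_nhds ha] with x hx
      using (integrable_slice hf.continuousOn (hUW x hx)).1
  · exact Filter.Eventually.of_forall fun t x hx => le_of_lt (huv (mk_mem_prod hx (htv t.2))).2
  · refine Filter.Eventually.of_forall fun t x hx => ?_
    have hxt : (x, (t : ℝ)) ∈ W := (huv (mk_mem_prod hx (htv t.2))).1
    have h1 : HasFDerivAt f (fderiv ℝ f (x, t)) (x, (t : ℝ)) :=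
      ((hf.contDiffAt (hW.mem_nhds hxt)).differentiableAt (by simp)).hasFDerivAt
    exact HasFDerivAt.comp (f := fun x : E => (x, (t : ℝ))) x h1 (hasFDerivAt_prodMk_left x (t : ℝ))

/-- The derivative of the integral is an integral of the same kind, with values in `E →L[ℝ] F`. The
induction must therefore quantify over all targets `F`, and `E` and `F` share a universe so that
this space is again admissible. -/
lemma contDiffOn_integral_slice_nat (hU : IsOpen U) (hW : IsOpen W)
    (hUW : ∀ a ∈ U, ∀ t ∈ Icc (0 : ℝ) 1, (a, t) ∈ W) (n : ℕ) :
    ∀ {F : Type u} [NormedAddCommGroup F] [NormedSpace ℝ F] {f : E × ℝ → F},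
      ContDiffOn ℝ ∞ f W → ContDiffOn ℝ n (fun x => ∫ t : Icc (0 : ℝ) 1, f (x, t)) U := by
  induction n with
  | zero =>
    intro F _ _ f hf
    refine contDiffOn_zero.2 fun a ha => ?_
    exact (hasFDerivAt_integral_slice hU hW hUW (hf.of_le (by simp))
      ha).continuousAt.continuousWithinAt
  | succ n ih =>
    intro F _ _ f hf
    have h1 := fun a (ha : a ∈ U) =>
      hasFDerivAt_integral_slice hU hW hUW (hf.of_le (by simp)) ha
    push_cast
    rw [contDiffOn_succ_iff_fderiv_of_isOpen hU]
    refine ⟨fun a ha => (h1 a ha).differentiableAt.differentiableWithinAt, by simp, ?_⟩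
    have h2 : ContDiffOn ℝ ∞
        (fun q => (fderiv ℝ f q).comp (ContinuousLinearMap.inl ℝ E ℝ)) W :=
      (hf.fderiv_of_isOpen hW (by simp)).clm_comp contDiffOn_const
    exact (ih h2).congr fun a ha => (h1 a ha).fderiv

/-- Integrals of smooth functions over the unit interval depend smoothly on parameters. -/
lemma contDiffOn_integral_slice (hU : IsOpen U) (hW : IsOpen W)
    (hUW : ∀ a ∈ U, ∀ t ∈ Icc (0 : ℝ) 1, (a, t) ∈ W) (hf : ContDiffOn ℝ ∞ f W) :
    ContDiffOn ℝ ∞ (fun x => ∫ t : Icc (0 : ℝ) 1, f (x, t)) U :=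
  contDiffOn_infty.2 fun n => contDiffOn_integral_slice_nat hU hW hUW n hf

/-- The fundamental theorem of calculus for an integral over the unit interval. -/
lemma integral_unitInterval_fderiv [CompleteSpace F] (hW : IsOpen W) {a : E}
    (ha : ∀ t ∈ Icc (0 : ℝ) 1, (a, t) ∈ W) (hf : ContDiffOn ℝ 1 f W) :
    ∫ t : Icc (0 : ℝ) 1, fderiv ℝ f (a, t) (0, 1) = f (a, 1) - f (a, 0) := by
  have hdf : ContinuousOn (fun q => fderiv ℝ f q (0, 1)) W :=
    (hf.continuousOn_fderiv_of_isOpen hW (by simp)).clm_apply continuousOn_const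
  have h1 : ∫ t : Icc (0 : ℝ) 1, fderiv ℝ f (a, t) (0, 1) =
      ∫ t in Icc (0 : ℝ) 1, fderiv ℝ f (a, t) (0, 1) :=
    integral_subtype_comap measurableSet_Icc fun t : ℝ => fderiv ℝ f (a, t) (0, 1)
  rw [h1, integral_Icc_eq_integral_Ioc, ← intervalIntegral.integral_of_le zero_le_one]
  refine intervalIntegral.integral_eq_sub_of_hasDerivAt (f := fun t => f (a, t)) (fun t ht => ?_) ?_
  · rw [uIcc_of_le zero_le_one] at ht
    have h2 : HasFDerivAt f (fderiv ℝ f (a, t)) (a, t) :=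
      ((hf.contDiffAt (hW.mem_nhds (ha t ht))).differentiableAt (by simp)).hasFDerivAt
    exact h2.comp_hasDerivAt t ((hasDerivAt_const t a).prodMk (hasDerivAt_id t))
  · refine ContinuousOn.intervalIntegrable ?_
    rw [uIcc_of_le zero_le_one]
    exact hdf.comp (by fun_prop) ha

end ParametricIntegral

end StiefelForms

namespace StiefelForms

/-! ### Cartan's formula for `∂_t` and the homotopy formula -/

section HomotopyFormula

open MeasureTheory

universe u

variable {E : Type u} [NormedAddCommGroup E] [NormedSpace ℝ E]

variable (E) in
/-- The contraction of a form on `E × ℝ` with the unit vector `∂_t`, restricted to `E`. -/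
def contractCLM (p : ℕ) : (E × ℝ) [⋀^Fin (p + 1)]→L[ℝ] ℝ →L[ℝ] E [⋀^Fin p]→L[ℝ] ℝ :=
  (ContinuousAlternatingMap.compContinuousLinearMapCLM (ContinuousLinearMap.inl ℝ E ℝ)).comp
    ((ContinuousLinearMap.apply ℝ ((E × ℝ) [⋀^Fin p]→L[ℝ] ℝ) ((0, 1) : E × ℝ)).comp
      (ContinuousAlternatingMap.curryLeftLI (𝕜 := ℝ) (E := E × ℝ) (F := ℝ)
        (n := p)).toContinuousLinearMap)

lemma contractCLM_apply {p : ℕ} (A : (E × ℝ) [⋀^Fin (p + 1)]→L[ℝ] ℝ) (v : Fin p → E) :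
    contractCLM E p A v = A (Matrix.vecCons (0, 1) fun i => (v i, 0)) := rfl

variable (E) in
/-- The restriction of a form on `E × ℝ` to `E`. -/
def restrictCLM (p : ℕ) : (E × ℝ) [⋀^Fin p]→L[ℝ] ℝ →L[ℝ] E [⋀^Fin p]→L[ℝ] ℝ :=
  ContinuousAlternatingMap.compContinuousLinearMapCLM (ContinuousLinearMap.inl ℝ E ℝ)

lemma restrictCLM_apply {p : ℕ} (A : (E × ℝ) [⋀^Fin p]→L[ℝ] ℝ) (v : Fin p → E) :
    restrictCLM E p A v = A fun i => (v i, 0) := rfl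

lemma removeNth_succ_vecCons {X : Type*} {p : ℕ} (x : X) (v : Fin (p + 1) → X) (i : Fin (p + 1)) :
    (i.succ).removeNth (Matrix.vecCons x v : Fin (p + 2) → X) =
      (Matrix.vecCons x (i.removeNth v) : Fin (p + 1) → X) := by
  ext j
  refine Fin.cases ?_ (fun j => ?_) j
  · simp [Fin.removeNth]
  · simp [Fin.removeNth]

/-- The contraction of the alternatization of a linear map with values in forms. -/
lemma contractCLM_alternatizeUncurryFin {p : ℕ}
    (A : E × ℝ →L[ℝ] (E × ℝ) [⋀^Fin (p + 1)]→L[ℝ] ℝ) :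
    contractCLM E (p + 1) (ContinuousAlternatingMap.alternatizeUncurryFin A) +
      ContinuousAlternatingMap.alternatizeUncurryFin
        (((contractCLM E p).comp A).comp (ContinuousLinearMap.inl ℝ E ℝ)) =
      restrictCLM E (p + 1) (A (0, 1)) := by
  ext v
  rw [ContinuousAlternatingMap.add_apply, contractCLM_apply,
    ContinuousAlternatingMap.alternatizeUncurryFin_apply, Fin.sum_univ_succ,
    ContinuousAlternatingMap.alternatizeUncurryFin_apply, add_assoc, ← Finset.sum_add_distrib,
    Finset.sum_eq_zero, add_zero, restrictCLM_apply]
  · simp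
  -- The term of index `0`, which differentiates along `∂_t`, is the right-hand side. In every other
  -- term `∂_t` stays in first position; the index is shifted by one against the second
  -- alternatization, so the signs are opposite and the terms cancel.
  · intro i _
    rw [removeNth_succ_vecCons]
    simp only [ContinuousLinearMap.comp_apply, contractCLM_apply, ContinuousLinearMap.inl_apply,
      Matrix.cons_val_succ, Fin.val_succ, pow_succ]
    simp only [mul_neg, mul_one, neg_smul]
    exact neg_add_cancel _

lemma contractCLM_alternatizeUncurryFin_zero (A : E × ℝ →L[ℝ] (E × ℝ) [⋀^Fin 0]→L[ℝ] ℝ) :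
    contractCLM E 0 (ContinuousAlternatingMap.alternatizeUncurryFin A) =
      restrictCLM E 0 (A (0, 1)) := by
  ext v
  rw [contractCLM_apply, ContinuousAlternatingMap.alternatizeUncurryFin_apply, restrictCLM_apply]
  simp

variable {U : Set E} {W : Set (E × ℝ)}

/-- Integration over the unit interval of forms on `E × ℝ`. -/
def intervalFibreIntegral {p : ℕ} (η : E × ℝ → (E × ℝ) [⋀^Fin (p + 1)]→L[ℝ] ℝ) (a : E) :
    E [⋀^Fin p]→L[ℝ] ℝ :=
  ∫ t : Icc (0 : ℝ) 1, contractCLM E p (η (a, t))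

lemma contDiffOn_intervalFibreIntegral (hU : IsOpen U) (hW : IsOpen W)
    (hUW : ∀ a ∈ U, ∀ t ∈ Icc (0 : ℝ) 1, (a, t) ∈ W) {p : ℕ}
    {η : E × ℝ → (E × ℝ) [⋀^Fin (p + 1)]→L[ℝ] ℝ} (hη : ContDiffOn ℝ ∞ η W) :
    ContDiffOn ℝ ∞ (intervalFibreIntegral η) U :=
  contDiffOn_integral_slice hU hW hUW ((contractCLM E p).contDiff.comp_contDiffOn hη)

lemma contDiffOn_extDeriv {F : Type*} [NormedAddCommGroup F] [NormedSpace ℝ F] {V : Set F}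
    (hV : IsOpen V) {p : ℕ} {η : F → F [⋀^Fin p]→L[ℝ] ℝ} (hη : ContDiffOn ℝ ∞ η V) :
    ContDiffOn ℝ ∞ (extDeriv η) V := by
  have h1 := hη.fderiv_of_isOpen (m := ∞) hV (by simp)
  exact (ContinuousAlternatingMap.alternatizeUncurryFinCLM ℝ F ℝ).contDiff.comp_contDiffOn h1

/-- The fundamental theorem of calculus for the form-valued function `t ↦ restrictCLM E p (η (a,
t))`, as `restrictCLM` is linear and commutes with differentiation. -/
lemma integral_restrictCLM_fderiv (hW : IsOpen W) {a : E}
    (ha : ∀ t ∈ Icc (0 : ℝ) 1, (a, t) ∈ W) {p : ℕ} {η : E × ℝ → (E × ℝ) [⋀^Fin p]→L[ℝ] ℝ}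
    (hη : ContDiffOn ℝ ∞ η W) :
    ∫ t : Icc (0 : ℝ) 1, restrictCLM E p (fderiv ℝ η (a, t) (0, 1)) =
      restrictCLM E p (η (a, 1)) - restrictCLM E p (η (a, 0)) := by
  have h := integral_unitInterval_fderiv hW ha
    (((restrictCLM E p).contDiff.comp_contDiffOn hη).of_le (by simp : (1 : WithTop ℕ∞) ≤ ∞))
  rw [← Function.comp_apply (f := restrictCLM E p), ← Function.comp_apply (f := restrictCLM E p), ← h]
  refine integral_congr_ae (Filter.Eventually.of_forall fun t => ?_)
  have hd : DifferentiableAt ℝ η (a, t) :=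
    (hη.contDiffAt (hW.mem_nhds (ha t t.2))).differentiableAt (by simp)
  simp only
  rw [((restrictCLM E p).hasFDerivAt.comp (a, (t : ℝ)) hd.hasFDerivAt).fderiv]
  rfl

theorem intervalFibreIntegral_extDeriv_zero (hW : IsOpen W) {a : E}
    (ha : ∀ t ∈ Icc (0 : ℝ) 1, (a, t) ∈ W) {η : E × ℝ → (E × ℝ) [⋀^Fin 0]→L[ℝ] ℝ}
    (hη : ContDiffOn ℝ ∞ η W) :
    intervalFibreIntegral (extDeriv η) a =
      restrictCLM E 0 (η (a, 1)) - restrictCLM E 0 (η (a, 0)) := by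
  rw [← integral_restrictCLM_fderiv hW ha hη, intervalFibreIntegral]
  simp only [extDeriv, contractCLM_alternatizeUncurryFin_zero]

/-- The homotopy formula `π_* d + d π_* = i₁^* - i₀^*` for forms on a neighbourhood of
`U × [0,1]`. -/
theorem intervalFibreIntegral_extDeriv_add (hU : IsOpen U) (hW : IsOpen W)
    (hUW : ∀ a ∈ U, ∀ t ∈ Icc (0 : ℝ) 1, (a, t) ∈ W) {p : ℕ}
    {η : E × ℝ → (E × ℝ) [⋀^Fin (p + 1)]→L[ℝ] ℝ} (hη : ContDiffOn ℝ ∞ η W) {a : E} (ha : a ∈ U) :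
    intervalFibreIntegral (extDeriv η) a + extDeriv (intervalFibreIntegral η) a =
      restrictCLM E (p + 1) (η (a, 1)) - restrictCLM E (p + 1) (η (a, 0)) := by
  have haW := hUW a ha
  have hc : ContDiffOn ℝ ∞ (contractCLM E p ∘ η) W := (contractCLM E p).contDiff.comp_contDiffOn hη
  have hdc : ContinuousOn
      (fun q => (fderiv ℝ (contractCLM E p ∘ η) q).comp (ContinuousLinearMap.inl ℝ E ℝ)) W :=
    (hc.continuousOn_fderiv_of_isOpen hW (by simp)).clm_comp continuousOn_const
  -- `d` is the continuous linear map `L` applied to the derivative. Hence `d` of the integral is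
  -- obtained by differentiating under the integral sign and then moving `L` inside.
  let L : (E →L[ℝ] E [⋀^Fin p]→L[ℝ] ℝ) →L[ℝ] E [⋀^Fin (p + 1)]→L[ℝ] ℝ :=
    ContinuousAlternatingMap.alternatizeUncurryFinCLM ℝ E ℝ
  have hint := integrable_slice (F := E →L[ℝ] E [⋀^Fin p]→L[ℝ] ℝ) hdc haW
  have h1 : fderiv ℝ (intervalFibreIntegral η) a = _ :=
    (hasFDerivAt_integral_slice hU hW hUW (hc.of_le (by simp)) ha).fderiv
  have h2 : extDeriv (intervalFibreIntegral η) a =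
      ∫ t : Icc (0 : ℝ) 1, L ((fderiv ℝ (contractCLM E p ∘ η) (a, t)).comp (ContinuousLinearMap.inl ℝ E ℝ)) := by
    rw [extDeriv, h1]
    exact (ContinuousLinearMap.integral_comp_comm (E := E →L[ℝ] E [⋀^Fin p]→L[ℝ] ℝ)
      (Fₗ := E [⋀^Fin (p + 1)]→L[ℝ] ℝ) (𝕜 := ℝ) L hint).symm
  have h3 : ContinuousOn (fun q => contractCLM E (p + 1) (extDeriv η q)) W :=
    (contractCLM E (p + 1)).continuous.comp_continuousOn (contDiffOn_extDeriv hW hη).continuousOn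
  rw [← integral_restrictCLM_fderiv hW haW hη, h2, intervalFibreIntegral]
  refine (integral_add (integrable_slice h3 haW)
    (ContinuousLinearMap.integrable_comp (H := E →L[ℝ] E [⋀^Fin p]→L[ℝ] ℝ)
      (E := E [⋀^Fin (p + 1)]→L[ℝ] ℝ) (𝕜 := ℝ) L hint)).symm.trans ?_
  -- Both sides are now integrals over `t`, and the integrands agree by the pointwise Cartan
  -- identity for `A = fderiv ℝ η (a, t)`.
  refine integral_congr_ae (Filter.Eventually.of_forall fun t => ?_)
  have hd : DifferentiableAt ℝ η (a, t) :=
    (hη.contDiffAt (hW.mem_nhds (haW t t.2))).differentiableAt (by simp)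
  simp only
  rw [← contractCLM_alternatizeUncurryFin, ((contractCLM E p).hasFDerivAt.comp (a, (t : ℝ)) hd.hasFDerivAt).fderiv]
  rfl

end HomotopyFormula

end StiefelForms

namespace StiefelForms

/-! ### Smoothness and equivariance of Gram–Schmidt -/

section GramSchmidt

open InnerProductSpace

variable {d m : ℕ}

lemma gramSchmidt_eq_sub {V : Type*} [NormedAddCommGroup V] [InnerProductSpace ℝ V]
    (v : Fin d → V) (k : Fin d) :
    gramSchmidt ℝ v k = v k - ∑ i ∈ Finset.Iio k,
      (⟪gramSchmidt ℝ v i, v k⟫ / ‖gramSchmidt ℝ v i‖ ^ 2) • gramSchmidt ℝ v i :=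
  eq_sub_of_add_eq (gramSchmidt_def'' ℝ v k).symm

/-- Gram--Schmidt orthogonalization commutes with linear isometries. -/
lemma gramSchmidt_map {V V' : Type*} [NormedAddCommGroup V] [InnerProductSpace ℝ V]
    [NormedAddCommGroup V'] [InnerProductSpace ℝ V'] (L : V →ₗᵢ[ℝ] V') (v : Fin d → V) (k : Fin d) :
    gramSchmidt ℝ (fun j => L (v j)) k = L (gramSchmidt ℝ v k) := by
  induction k using WellFoundedLT.induction with
  | ind k ih =>
    rw [gramSchmidt_eq_sub, gramSchmidt_eq_sub v k, map_sub, map_sum]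
    congr 1
    refine Finset.sum_congr rfl fun i hi => ?_
    rw [ih i (Finset.mem_Iio.1 hi), L.inner_map_map, L.norm_map, map_smul]

lemma gramSchmidtNormed_map {V V' : Type*} [NormedAddCommGroup V] [InnerProductSpace ℝ V]
    [NormedAddCommGroup V'] [InnerProductSpace ℝ V'] (L : V →ₗᵢ[ℝ] V') (v : Fin d → V) (k : Fin d) :
    gramSchmidtNormed ℝ (fun j => L (v j)) k = L (gramSchmidtNormed ℝ v k) := by
  rw [gramSchmidtNormed, gramSchmidtNormed, gramSchmidt_map, L.norm_map, map_smul]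

lemma gramSchmidtNormed_of_orthonormal {V : Type*} [NormedAddCommGroup V] [InnerProductSpace ℝ V]
    {v : Fin d → V} (hv : Orthonormal ℝ v) : gramSchmidtNormed ℝ v = v := by
  ext1 k
  rw [gramSchmidtNormed, gramSchmidt_of_orthogonal ℝ hv.2, hv.1 k]
  simp

/-- The Gram--Schmidt orthonormalization of the columns, defined on all linear maps. -/
def gramSchmidtCols (α : LinMap d m) : LinMap d m := ofCols (gramSchmidtNormed ℝ (col α))

/-- Strong induction along the recursion. The denominators are squared norms of earlier Gram–Schmidt
vectors, which do not vanish when the columns are independent. -/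
lemma contDiffOn_gramSchmidt (k : Fin d) :
    ContDiffOn ℝ ∞ (fun α : LinMap d m => gramSchmidt ℝ (col α) k) (Inj d m) := by
  induction k using WellFoundedLT.induction with
  | ind k ih =>
    simp only [gramSchmidt_eq_sub _ k]
    refine (contDiff_col k).contDiffOn.sub (ContDiffOn.sum fun i hi => ?_)
    have hi' := ih i (Finset.mem_Iio.1 hi)
    refine ContDiffOn.smul (ContDiffOn.div (hi'.inner ℝ (contDiff_col k).contDiffOn)
      (hi'.norm_sq ℝ) fun α hα => ?_) hi'
    have := gramSchmidt_ne_zero i ((injective_iff_col α).1 hα)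
    positivity

lemma contDiffOn_gramSchmidtCols :
    ContDiffOn ℝ ∞ (gramSchmidtCols : LinMap d m → LinMap d m) (Inj d m) := by
  unfold gramSchmidtCols ofCols
  refine ContDiffOn.sum fun k _ => contDiffOn_const.smulRight ?_
  have hne : ∀ α ∈ (Inj d m : Set (LinMap d m)), gramSchmidt ℝ (col α) k ≠ 0 := fun α hα =>
    gramSchmidt_ne_zero k ((injective_iff_col α).1 hα)
  exact ((contDiffOn_gramSchmidt k).norm ℝ hne).inv (fun α hα => norm_ne_zero_iff.2 (hne α hα))
    |>.smul (contDiffOn_gramSchmidt k)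

/-- The action of an element of `SO(m)` on `ℝ^m` as a linear isometry. -/
def SO.toIsometry (g : SO m) : EuclideanSpace ℝ (Fin m) →ₗᵢ[ℝ] EuclideanSpace ℝ (Fin m) :=
  ⟨SO.toLin g, SO.norm_toLin g⟩

lemma ofCols_comp (L : LinMap m m) (v : Fin d → EuclideanSpace ℝ (Fin m)) :
    ofCols (fun j => L (v j)) = L.comp (ofCols v) := by
  ext1 x
  simp [ofCols_apply]

lemma gramSchmidtCols_comp (g : SO m) (α : LinMap d m) :
    gramSchmidtCols ((SO.toLin g).comp α) = (SO.toLin g).comp (gramSchmidtCols α) := by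
  rw [gramSchmidtCols, gramSchmidtCols, ← ofCols_comp]
  congr 1
  ext1 k
  exact gramSchmidtNormed_map (SO.toIsometry g) (col α) k

instance : SMul (SO m) (Inj d m) := (inferInstance : MulAction (SO m) (Inj d m)).toSMul

instance : SMul (SO m) (Stiefel m d) := (inferInstance : MulAction (SO m) (Stiefel m d)).toSMul

lemma gramSchmidtMap_smul (g : SO m) (α : Inj d m) :
    gramSchmidtMap m d (g • α) = g • gramSchmidtMap m d α :=
  Stiefel.ext (gramSchmidtCols_comp g α.1)

lemma incl_smul (g : SO m) (a : Stiefel m d) : incl m d (g • a) = g • incl m d a := rfl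

lemma gramSchmidtMap_comp_incl : gramSchmidtMap m d ∘ incl m d = id := by
  ext1 a
  refine Stiefel.ext ?_
  change ofCols (gramSchmidtNormed ℝ (col a.1)) = a.1
  rw [gramSchmidtNormed_of_orthonormal a.orthonormal, ofCols_col]

/-- In the chart at `a` the inclusion reads as the inverse of that chart, which is smooth into the
linear maps by construction. -/
lemma contMDiff_stiefelVal : ContMDiff 𝓘(ℝ, StiefelModel m d) 𝓘(ℝ, LinMap d m) ∞
    (Stiefel.val : Stiefel m d → LinMap d m) := by
  intro a
  rw [contMDiffAt_iff]
  refine ⟨continuous_stiefelVal.continuousAt, ?_⟩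
  have h := (contDiffOn_stiefelChart_symm a).contDiffAt
    ((stiefelChart a).open_target.mem_nhds (mem_chart_target (StiefelModel m d) a))
  exact h.contDiffWithinAt

/-- A map to the Stiefel manifold is smooth if it is smooth as a map to the linear maps. -/
lemma contMDiff_stiefel {E : Type*} [NormedAddCommGroup E] [NormedSpace ℝ E] {M : Type*}
    [TopologicalSpace M] [ChartedSpace E M] {f : M → Stiefel m d}
    (hf : ContMDiff 𝓘(ℝ, E) 𝓘(ℝ, LinMap d m) ∞ fun x => (f x).1) :
    ContMDiff 𝓘(ℝ, E) 𝓘(ℝ, StiefelModel m d) ∞ f := by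
  have hind : Topology.IsInducing (Stiefel.val : Stiefel m d → LinMap d m) := ⟨rfl⟩
  intro x
  rw [contMDiffAt_iff_target]
  refine ⟨(hind.continuous_iff.2 hf.continuous).continuousAt, ?_⟩
  -- The chart at `f x` is the restriction of `coord (f x)`, which is smooth on the space of all
  -- linear maps.
  exact (contDiff_coord (f x)).contMDiff.contMDiffAt.comp x (hf x)

lemma contMDiff_incl : ContMDiff 𝓘(ℝ, StiefelModel m d) 𝓘(ℝ, LinMap d m) ∞ (incl m d) :=
  (ContMDiff.subtypeVal_comp_iff (Inj d m) (incl m d)).1 contMDiff_stiefelVal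

lemma contMDiff_gramSchmidtMap :
    ContMDiff 𝓘(ℝ, LinMap d m) 𝓘(ℝ, StiefelModel m d) ∞ (gramSchmidtMap m d) :=
  contMDiff_stiefel fun α => contMDiffAt_subtype_iff.2
    (contDiffOn_gramSchmidtCols.contDiffAt ((Inj d m).2.mem_nhds α.2)).contMDiffAt

lemma contMDiff_comp_left (L : LinMap m m) : ContMDiff 𝓘(ℝ, LinMap d m) 𝓘(ℝ, LinMap d m) ∞
    fun α : LinMap d m => L.comp α :=
  ContDiff.contMDiff (contDiff_const.clm_comp contDiff_id)

lemma contMDiff_smul_inj (g : SO m) :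
    ContMDiff 𝓘(ℝ, LinMap d m) 𝓘(ℝ, LinMap d m) ∞ (g • · : Inj d m → Inj d m) :=
  (ContMDiff.subtypeVal_comp_iff (Inj d m) _).1
    ((contMDiff_comp_left (SO.toLin g)).comp contMDiff_subtype_val)

lemma contMDiff_smul_stiefel (g : SO m) : ContMDiff 𝓘(ℝ, StiefelModel m d) 𝓘(ℝ, StiefelModel m d) ∞
    (g • · : Stiefel m d → Stiefel m d) :=
  contMDiff_stiefel ((contMDiff_comp_left (SO.toLin g)).comp contMDiff_stiefelVal)

end GramSchmidt

end StiefelForms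

namespace StiefelForms

/-! ### The homotopy operator on `Inj d m` -/

section Homotopy

open MeasureTheory

variable {d m : ℕ}

/-- The homotopy from the identity to Gram--Schmidt orthonormalization, for all linear maps and all
real times. -/
def linHomotopy (q : LinMap d m × ℝ) : LinMap d m := (1 - q.2) • q.1 + q.2 • gramSchmidtCols q.1

variable (d m) in
/-- The set of all `(α, t)` with `α` and `linHomotopy (α, t)` injective. -/
def homotopyDomain : Set (LinMap d m × ℝ) :=
  (Inj d m : Set (LinMap d m)) ×ˢ univ ∩ linHomotopy ⁻¹' Inj d m

lemma contDiffOn_linHomotopy : ContDiffOn ℝ ∞ (linHomotopy : LinMap d m × ℝ → LinMap d m)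
    ((Inj d m : Set (LinMap d m)) ×ˢ univ) := by
  have h : ContDiffOn ℝ ∞ (fun q : LinMap d m × ℝ => gramSchmidtCols q.1)
      ((Inj d m : Set (LinMap d m)) ×ˢ univ) :=
    contDiffOn_gramSchmidtCols.comp contDiffOn_fst fun q hq => hq.1
  unfold linHomotopy
  fun_prop

/-- Openness is the reason for admitting all real times: `Inj d m × [0,1]` acquires an open
neighbourhood in a normed space, where `fderiv` and `extDeriv` apply without regard to the boundary
of the interval. -/
lemma isOpen_homotopyDomain : IsOpen (homotopyDomain d m) :=
  contDiffOn_linHomotopy.continuousOn.isOpen_inter_preimage ((Inj d m).2.prod isOpen_univ)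
    (Inj d m).2

lemma contDiffOn_linHomotopy_homotopyDomain :
    ContDiffOn ℝ ∞ (linHomotopy : LinMap d m × ℝ → LinMap d m) (homotopyDomain d m) :=
  contDiffOn_linHomotopy.mono inter_subset_left

lemma mem_homotopyDomain (α : LinMap d m) (hα : α ∈ (Inj d m : Set (LinMap d m))) (t : ℝ)
    (ht : t ∈ Icc (0 : ℝ) 1) : (α, t) ∈ homotopyDomain d m :=
  ⟨⟨hα, mem_univ _⟩, homotopy_injective ⟨α, hα⟩ ht.1 ht.2⟩

lemma hasFDerivAt_linHomotopy {q : LinMap d m × ℝ} (hq : q ∈ homotopyDomain d m) :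
    HasFDerivAt linHomotopy (fderiv ℝ linHomotopy q) q :=
  ((contDiffOn_linHomotopy_homotopyDomain.contDiffAt
    (isOpen_homotopyDomain.mem_nhds hq)).differentiableAt (by simp)).hasFDerivAt

/-- The pullback of a form on `Inj(d,m)` along `linHomotopy`. -/
def homotopyPull {p : ℕ} (θ : FormField (LinMap d m) (Inj d m) p) (q : LinMap d m × ℝ) :
    (LinMap d m × ℝ) [⋀^Fin p]→L[ℝ] ℝ :=
  (flat θ (linHomotopy q)).compContinuousLinearMap (fderiv ℝ linHomotopy q)

lemma contDiffOn_homotopyPull {p : ℕ} {θ : FormField (LinMap d m) (Inj d m) p}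
    (hθ : IsSmoothForm θ) : ContDiffOn ℝ ∞ (homotopyPull θ) (homotopyDomain d m) :=
  ContDiffOn.compContinuousLinearMap
    ((isSmoothForm_opens_iff.1 hθ).comp contDiffOn_linHomotopy_homotopyDomain fun _ hq => hq.2)
    (contDiffOn_linHomotopy_homotopyDomain.fderiv_of_isOpen isOpen_homotopyDomain (by simp))

lemma extDeriv_homotopyPull {p : ℕ} {θ : FormField (LinMap d m) (Inj d m) p}
    (hθ : IsSmoothForm θ) {q : LinMap d m × ℝ} (hq : q ∈ homotopyDomain d m) :
    extDeriv (homotopyPull θ) q = homotopyPull (extDerivField θ) q := by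
  have h1 : DifferentiableAt ℝ (flat θ) (linHomotopy q) :=
    ((isSmoothForm_opens_iff.1 hθ).contDiffAt ((Inj d m).2.mem_nhds hq.2)).differentiableAt (by simp)
  have h2 := contDiffOn_linHomotopy_homotopyDomain.contDiffAt (isOpen_homotopyDomain.mem_nhds hq)
  unfold homotopyPull
  rw [extDeriv_pullback (r := ∞) h1 h2 (by
    simp only [minSmoothness_of_isRCLikeNormedField]
    exact WithTop.coe_le_coe.2 (le_top : (2 : ℕ∞) ≤ ⊤)), flat_of_mem (extDerivField θ) hq.2,
    extDerivField_opens]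

/-- Used to ensure that `mfderiv` of the homotopy is its true differential and not the default value
`0`. -/
lemma contMDiff_homotopy : ContMDiff (𝓘(ℝ, LinMap d m).prod (𝓡∂ 1)) 𝓘(ℝ, LinMap d m) ∞
    (homotopy m d) := by
  refine (ContMDiff.subtypeVal_comp_iff (Inj d m) _).1 fun q => ?_
  have h1 := (contDiffOn_linHomotopy_homotopyDomain.contDiffAt (isOpen_homotopyDomain.mem_nhds
    (mem_homotopyDomain q.1.1 q.1.2 q.2 q.2.2))).contMDiffAt
  have h2 : ContMDiff (𝓘(ℝ, LinMap d m).prod (𝓡∂ 1)) 𝓘(ℝ, LinMap d m × ℝ) ∞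
      fun q : Inj d m × Icc (0 : ℝ) 1 => ((q.1 : LinMap d m), (q.2 : ℝ)) :=
    ContMDiff.prodMk_space (contMDiff_subtype_val.comp contMDiff_fst)
      (contMDiff_subtypeVal_Icc.comp contMDiff_snd)
  exact ContMDiffAt.comp (g := linHomotopy)
    (f := fun q : Inj d m × Icc (0 : ℝ) 1 => ((q.1 : LinMap d m), (q.2 : ℝ))) q h1 (h2 q)

/-- The differential of a map to an open subset of a normed space. -/
lemma mfderiv_subtypeVal_comp {E : Type*} [NormedAddCommGroup E] [NormedSpace ℝ E]
    {U : TopologicalSpace.Opens E} {E' : Type*} [NormedAddCommGroup E'] [NormedSpace ℝ E']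
    {H' : Type*} [TopologicalSpace H'] {I : ModelWithCorners ℝ E' H'} {M : Type*}
    [TopologicalSpace M] [ChartedSpace H' M] {f : M → U} {x : M}
    (hf : MDifferentiableAt I 𝓘(ℝ, E) f x) :
    differentialAt I 𝓘(ℝ, E) (Subtype.val ∘ f) x = differentialAt I 𝓘(ℝ, E) f x := by
  have h : mfderiv I 𝓘(ℝ, E) (Subtype.val ∘ f) x = _ :=
    mfderiv_comp x ((contMDiff_subtype_val (n := 1)).mdifferentiable (by simp) (f x)) hf
  rw [differentialAt, h, mfderiv_subtypeVal_opens]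
  rfl

lemma hasMFDerivAt_prodMk_space {E E' E'' : Type*} [NormedAddCommGroup E] [NormedSpace ℝ E]
    [NormedAddCommGroup E'] [NormedSpace ℝ E'] [NormedAddCommGroup E''] [NormedSpace ℝ E'']
    {H : Type*} [TopologicalSpace H] {I : ModelWithCorners ℝ E H} {M : Type*}
    [TopologicalSpace M] [ChartedSpace H M] {f : M → E'} {g : M → E''} {x : M}
    {df : TangentSpace I x →L[ℝ] E'} {dg : TangentSpace I x →L[ℝ] E''}
    (hf : HasMFDerivAt I 𝓘(ℝ, E') f x df) (hg : HasMFDerivAt I 𝓘(ℝ, E'') g x dg) :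
    HasMFDerivAt I 𝓘(ℝ, E' × E'') (fun y => (f y, g y)) x (df.prod dg) :=
  ⟨hf.1.prodMk hg.1, hf.2.prodMk hg.2⟩

/-- The differential of a map `U × [0,1] → U` given by a differentiable function on `E × ℝ`. -/
lemma mfderiv_opens_prod_Icc {E : Type*} [NormedAddCommGroup E] [NormedSpace ℝ E]
    {U : TopologicalSpace.Opens E} {f : U × Icc (0 : ℝ) 1 → U} {F : E × ℝ → E}
    (hfF : ∀ q, (f q : E) = F (q.1, q.2)) {α : U} {t : Icc (0 : ℝ) 1}
    (hf : MDifferentiableAt (𝓘(ℝ, E).prod (𝓡∂ 1)) 𝓘(ℝ, E) f (α, t))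
    (hF : DifferentiableAt ℝ F (α, t)) (v : E) (s : TangentSpace (𝓡∂ 1) t) :
    differentialAt (𝓘(ℝ, E).prod (𝓡∂ 1)) 𝓘(ℝ, E) f (α, t) (v, s) =
      fderiv ℝ F (α.1, (t : ℝ))
        (v, mfderiv (𝓡∂ 1) 𝓘(ℝ) (Subtype.val : Icc (0 : ℝ) 1 → ℝ) t s) := by
  have h1 : HasMFDerivAt 𝓘(ℝ, E) 𝓘(ℝ, E) (Subtype.val : U → E) α
      (ContinuousLinearMap.id ℝ E) := by
    rw [← mfderiv_subtypeVal_opens α]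
    exact ((contMDiff_subtype_val (n := 1)).mdifferentiable (by simp) α).hasMFDerivAt
  have h2 : HasMFDerivAt (𝓡∂ 1) 𝓘(ℝ) (Subtype.val : Icc (0 : ℝ) 1 → ℝ) t _ :=
    ((contMDiff_subtypeVal_Icc (n := 1)).mdifferentiable (by simp) t).hasMFDerivAt
  have h3 := hasMFDerivAt_prodMk_space
    (HasMFDerivAt.comp (α, t) h1 (hasMFDerivAt_fst (I' := 𝓡∂ 1) (α, t)))
    (HasMFDerivAt.comp (α, t) h2 (hasMFDerivAt_snd (I := 𝓘(ℝ, E)) (α, t)))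
  have h4 := HasMFDerivAt.comp (g := F) (α, t) hF.hasFDerivAt.hasMFDerivAt h3
  have h5 : Subtype.val ∘ f = F ∘ fun q : U × Icc (0 : ℝ) 1 => ((q.1 : E), (q.2 : ℝ)) :=
    funext hfF
  rw [← mfderiv_subtypeVal_comp hf, h5]
  exact DFunLike.congr_fun h4.mfderiv (v, s)

lemma mfderiv_homotopy (α : Inj d m) (t : Icc (0 : ℝ) 1) (v : LinMap d m)
    (s : TangentSpace (𝓡∂ 1) t) :
    differentialAt (𝓘(ℝ, LinMap d m).prod (𝓡∂ 1)) 𝓘(ℝ, LinMap d m) (homotopy m d) (α, t) (v, s) =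
      fderiv ℝ linHomotopy (α.1, (t : ℝ))
        (v, mfderiv (𝓡∂ 1) 𝓘(ℝ) (Subtype.val : Icc (0 : ℝ) 1 → ℝ) t s) :=
  mfderiv_opens_prod_Icc (fun _ => rfl) (contMDiff_homotopy.mdifferentiable (by simp) _)
    (hasFDerivAt_linHomotopy (mem_homotopyDomain α.1 α.2 t t.2)).differentiableAt v s

/-- The two integrands agree pointwise: the inclusion of `[0,1]` in `ℝ` sends `oneTangentSpaceIcc t`
to `1`, so `∂_t` on the manifold with boundary becomes the vector `(0, 1)`, while horizontal vectors
are unchanged. -/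
lemma fibreIntegral_pullbackField_homotopy {p : ℕ}
    (θ : FormField (LinMap d m) (Inj d m) (p + 1)) (α : Inj d m) :
    fibreIntegral (pullbackField (𝓘(ℝ, LinMap d m).prod (𝓡∂ 1)) 𝓘(ℝ, LinMap d m) (homotopy m d) θ) α
      = intervalFibreIntegral (homotopyPull θ) α := by
  unfold fibreIntegral intervalFibreIntegral
  congr 1
  ext t v
  rw [contractCLM_apply, homotopyPull, flat_of_mem θ (mem_homotopyDomain α.1 α.2 t t.2).2]
  change θ (homotopy m d (α, t)) _ = θ (homotopy m d (α, t)) _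
  congr 1
  ext1 i
  refine Fin.cases ?_ (fun i => ?_) i
  · refine (mfderiv_homotopy α t 0 (oneTangentSpaceIcc t)).trans ?_
    have h := mfderiv_subtypeVal_Icc_one t
    exact congrArg (fun s : ℝ => fderiv ℝ linHomotopy (α.1, (t : ℝ)) (0, s)) h
  · refine (mfderiv_homotopy α t (v i) 0).trans ?_
    rw [map_zero]
    rfl

/-- The homotopy operator. -/
def homotopyOperator (d m p : ℕ) :
    DiffForm (LinMap d m) (Inj d m) (p + 1) →ₗ[ℝ] DiffForm (LinMap d m) (Inj d m) p where
  toFun θ := ⟨fun α => intervalFibreIntegral (homotopyPull θ.field) α.1, by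
    refine isSmoothForm_opens_iff.2 ((contDiffOn_intervalFibreIntegral (Inj d m).2
      isOpen_homotopyDomain mem_homotopyDomain (contDiffOn_homotopyPull θ.smooth)).congr
        fun α hα => flat_of_mem _ hα)⟩
  map_add' θ η := by
    refine DiffForm.ext (funext fun α => ?_)
    -- Additivity of the integral requires integrable summands; smoothness of the forms enters here.
    have h : ∀ ζ : DiffForm (LinMap d m) (Inj d m) (p + 1), Integrable fun t : Icc (0 : ℝ) 1 =>
        contractCLM _ p (homotopyPull ζ.field (α.1, t)) := fun ζ =>
      integrable_slice ((contractCLM _ p).continuous.comp_continuousOn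
        (contDiffOn_homotopyPull ζ.smooth).continuousOn) (mem_homotopyDomain α.1 α.2)
    refine Eq.trans ?_ (integral_add (h θ) (h η))
    refine integral_congr_ae (Filter.Eventually.of_forall fun t => ?_)
    simp only [← map_add]
    congr 1
    have hq := (mem_homotopyDomain α.1 α.2 t t.2).2
    simp only [homotopyPull, flat_of_mem _ hq]
    rfl
  map_smul' c θ := by
    refine DiffForm.ext (funext fun α => ?_)
    have h : c • (∫ t : Icc (0 : ℝ) 1, contractCLM _ p (homotopyPull θ.field (α.1, t))) = _ :=
      (integral_smul c _).symm
    refine Eq.trans ?_ h.symm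
    refine integral_congr_ae (Filter.Eventually.of_forall fun t => ?_)
    simp only [← map_smul]
    congr 1
    have hq := (mem_homotopyDomain α.1 α.2 t t.2).2
    simp only [homotopyPull, flat_of_mem _ hq]
    rfl

lemma linHomotopy_zero (α : LinMap d m) : linHomotopy (α, 0) = α := by
  rw [linHomotopy, sub_zero, one_smul ℝ α, zero_smul ℝ (gramSchmidtCols α), add_zero]

lemma linHomotopy_one (α : LinMap d m) : linHomotopy (α, 1) = gramSchmidtCols α := by
  rw [linHomotopy, sub_self, one_smul ℝ (gramSchmidtCols α), zero_smul ℝ α, zero_add]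

lemma fderiv_linHomotopy_slice {α : LinMap d m} {t : ℝ} (h : (α, t) ∈ homotopyDomain d m)
    (v : LinMap d m) :
    fderiv ℝ linHomotopy (α, t) (v, 0) = fderiv ℝ (fun x => linHomotopy (x, t)) α v := by
  have h1 := HasFDerivAt.comp (f := fun x : LinMap d m => (x, t)) α (hasFDerivAt_linHomotopy h)
    (hasFDerivAt_prodMk_left α t)
  exact (DFunLike.congr_fun h1.fderiv v).symm

lemma restrictCLM_homotopyPull_zero {p : ℕ} (θ : FormField (LinMap d m) (Inj d m) p) (α : Inj d m) :
    restrictCLM _ p (homotopyPull θ (α.1, 0)) = θ α := by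
  have h := mem_homotopyDomain α.1 α.2 0 ⟨le_rfl, zero_le_one⟩
  ext v
  have h1 : ∀ i, fderiv ℝ linHomotopy (α.1, (0 : ℝ)) (v i, 0) = v i := fun i => by
    rw [fderiv_linHomotopy_slice h]
    simp only [linHomotopy_zero, fderiv_fun_id]
    rfl
  rw [restrictCLM_apply]
  change flat θ (linHomotopy (α.1, 0)) (fun i => fderiv ℝ linHomotopy (α.1, (0 : ℝ)) (v i, 0)) = _
  simp only [h1]
  rw [linHomotopy_zero, flat_coe]

/-- As a map to the linear maps, `ι ∘ Λ` is the restriction of `gramSchmidtCols` to an open set, so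
its differential can be computed without the charts of the Stiefel manifold. -/
lemma mfderiv_incl_comp_gramSchmidtMap (α : Inj d m) :
    differentialAt 𝓘(ℝ, LinMap d m) 𝓘(ℝ, LinMap d m) (incl m d ∘ gramSchmidtMap m d) α =
      fderiv ℝ gramSchmidtCols α.1 := by
  rw [← mfderiv_subtypeVal_comp
    ((contMDiff_incl.comp contMDiff_gramSchmidtMap).mdifferentiable (by simp) α)]
  have h1 : MDifferentiableAt 𝓘(ℝ, LinMap d m) 𝓘(ℝ, LinMap d m)
      (gramSchmidtCols : LinMap d m → LinMap d m) α.1 :=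
    ((contDiffOn_gramSchmidtCols.contDiffAt ((Inj d m).2.mem_nhds α.2)).differentiableAt
      (by simp)).mdifferentiableAt
  have h2 : mfderiv 𝓘(ℝ, LinMap d m) 𝓘(ℝ, LinMap d m)
      (gramSchmidtCols ∘ (Subtype.val : Inj d m → LinMap d m)) α = _ :=
    mfderiv_comp α h1 ((contMDiff_subtype_val (n := 1)).mdifferentiable (by simp) α)
  refine h2.trans ?_
  rw [mfderiv_subtypeVal_opens, mfderiv_eq_fderiv]
  rfl

lemma restrictCLM_homotopyPull_one {p : ℕ} (θ : FormField (LinMap d m) (Inj d m) p) (α : Inj d m) :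
    restrictCLM _ p (homotopyPull θ (α.1, 1)) =
      pull (gramSchmidtMap m d) (pull (E := StiefelModel m d) (incl m d) θ) α := by
  have h := mem_homotopyDomain α.1 α.2 1 ⟨zero_le_one, le_rfl⟩
  rw [← pull_comp (contMDiff_incl.mdifferentiable (by simp))
    (contMDiff_gramSchmidtMap.mdifferentiable (by simp))]
  have hp : pull (incl m d ∘ gramSchmidtMap m d) θ α =
      (θ ((incl m d ∘ gramSchmidtMap m d) α)).compContinuousLinearMap (fderiv ℝ gramSchmidtCols α.1) := by
    rw [← mfderiv_incl_comp_gramSchmidtMap]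
    rfl
  rw [hp]
  ext v
  have h1 : ∀ i, fderiv ℝ linHomotopy (α.1, (1 : ℝ)) (v i, 0) = fderiv ℝ gramSchmidtCols α.1 (v i) :=
    fun i => by
      rw [fderiv_linHomotopy_slice h]
      simp only [linHomotopy_one]
  rw [restrictCLM_apply]
  change flat θ (linHomotopy (α.1, 1)) (fun i => fderiv ℝ linHomotopy (α.1, (1 : ℝ)) (v i, 0)) = _
  simp only [h1]
  rw [linHomotopy_one]
  exact DFunLike.congr_fun (flat_coe θ ((incl m d ∘ gramSchmidtMap m d) α)) _

lemma intervalFibreIntegral_homotopyPull_extDerivField {p : ℕ}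
    (θ : DiffForm (LinMap d m) (Inj d m) p) (α : Inj d m) :
    intervalFibreIntegral (homotopyPull (extDerivField θ.field)) α.1 =
      intervalFibreIntegral (extDeriv (homotopyPull θ.field)) α.1 := by
  refine integral_congr_ae (Filter.Eventually.of_forall fun t => ?_)
  simp only
  rw [extDeriv_homotopyPull θ.smooth (mem_homotopyDomain α.1 α.2 t t.2)]

/-- Degree `0` is separate because the operator lowers the degree: the term `d (K θ)` is absent, by
the convention that the operator vanishes on functions. -/
theorem homotopy_formula_zero (θ : DiffForm (LinMap d m) (Inj d m) 0) :
    pull (gramSchmidtMap m d) (pull (E := StiefelModel m d) (incl m d) θ.field) - θ.field =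
      (homotopyOperator d m 0 (extD (LinMap d m) (Inj d m) 0 θ)).field := by
  ext1 α
  refine Eq.symm ((intervalFibreIntegral_homotopyPull_extDerivField θ α).trans ?_)
  rw [intervalFibreIntegral_extDeriv_zero isOpen_homotopyDomain (mem_homotopyDomain α.1 α.2)
    (contDiffOn_homotopyPull θ.smooth), restrictCLM_homotopyPull_zero, restrictCLM_homotopyPull_one]
  rfl

theorem homotopy_formula_succ {p : ℕ} (θ : DiffForm (LinMap d m) (Inj d m) (p + 1)) :
    pull (gramSchmidtMap m d) (pull (E := StiefelModel m d) (incl m d) θ.field) - θ.field =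
      (homotopyOperator d m (p + 1) (extD (LinMap d m) (Inj d m) (p + 1) θ) +
        extD (LinMap d m) (Inj d m) p (homotopyOperator d m p θ)).field := by
  ext1 α
  -- The two functions differ off `Inj d m`, but `extDeriv` at `α` depends only on the germ there.
  have h1 : flat (homotopyOperator d m p θ).field =ᶠ[𝓝 α.1]
      intervalFibreIntegral (homotopyPull θ.field) := by
    filter_upwards [(Inj d m).2.mem_nhds α.2] with x hx
    rw [flat_of_mem _ hx]
    rfl
  have h2 : (extD (LinMap d m) (Inj d m) p (homotopyOperator d m p θ)).field α =
      extDeriv (intervalFibreIntegral (homotopyPull θ.field)) α.1 :=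
    (extDerivField_opens _ α).trans h1.extDeriv_eq
  have h3 : (homotopyOperator d m (p + 1) (extD (LinMap d m) (Inj d m) (p + 1) θ)).field α =
      intervalFibreIntegral (extDeriv (homotopyPull θ.field)) α.1 :=
    intervalFibreIntegral_homotopyPull_extDerivField θ α
  rw [DiffForm.field_add, Pi.add_apply, h2, h3, intervalFibreIntegral_extDeriv_add (Inj d m).2
    isOpen_homotopyDomain mem_homotopyDomain (contDiffOn_homotopyPull θ.smooth) α.2,
    restrictCLM_homotopyPull_zero, restrictCLM_homotopyPull_one]
  rfl

end Homotopy

end StiefelForms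

namespace StiefelForms

/-! ### Equivariance of the homotopy and invariant forms -/

section Invariance

open MeasureTheory

variable {d m : ℕ}

/-- Composition with an element of `SO(m)`, as a linear map. -/
def SO.compLeft (d : ℕ) (g : SO m) : LinMap d m →L[ℝ] LinMap d m :=
  ContinuousLinearMap.compL ℝ (EuclideanSpace ℝ (Fin d)) (EuclideanSpace ℝ (Fin m))
    (EuclideanSpace ℝ (Fin m)) (SO.toLin g)

lemma differentialAt_smul_inj (g : SO m) (α : Inj d m) :
    differentialAt 𝓘(ℝ, LinMap d m) 𝓘(ℝ, LinMap d m) (g • · : Inj d m → Inj d m) α =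
      SO.compLeft d g := by
  rw [← mfderiv_subtypeVal_comp ((contMDiff_smul_inj g).mdifferentiable (by simp) α)]
  have h2 : mfderiv 𝓘(ℝ, LinMap d m) 𝓘(ℝ, LinMap d m)
      (SO.compLeft d g ∘ (Subtype.val : Inj d m → LinMap d m)) α = _ :=
    mfderiv_comp α (SO.compLeft d g).differentiableAt.mdifferentiableAt
      ((contMDiff_subtype_val (n := 1)).mdifferentiable (by simp) α)
  refine h2.trans ?_
  rw [mfderiv_subtypeVal_opens, mfderiv_eq_fderiv, ContinuousLinearMap.fderiv]
  rfl

lemma linHomotopy_compLeft (g : SO m) (q : LinMap d m × ℝ) :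
    linHomotopy (SO.compLeft d g q.1, q.2) = SO.compLeft d g (linHomotopy q) := by
  have h : gramSchmidtCols (SO.compLeft d g q.1) = SO.compLeft d g (gramSchmidtCols q.1) :=
    gramSchmidtCols_comp g q.1
  simp only [linHomotopy]
  rw [h, map_add, map_smul, map_smul]

/-- Obtained by differentiating the equivariance `linHomotopy_compLeft` with the chain rule on both
sides and using uniqueness of the derivative. -/
lemma fderiv_linHomotopy_compLeft (g : SO m) (α : Inj d m) {t : ℝ} (ht : t ∈ Icc (0 : ℝ) 1)
    (w : LinMap d m × ℝ) :
    fderiv ℝ linHomotopy (SO.compLeft d g α.1, t) (SO.compLeft d g w.1, w.2) =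
      SO.compLeft d g (fderiv ℝ linHomotopy (α.1, t) w) := by
  have h1 : HasFDerivAt (fun q : LinMap d m × ℝ => linHomotopy (SO.compLeft d g q.1, q.2)) _
      (α.1, t) := HasFDerivAt.comp (α.1, t)
    (f := (SO.compLeft d g).prodMap (ContinuousLinearMap.id ℝ ℝ))
    (hasFDerivAt_linHomotopy (mem_homotopyDomain (g • α).1 (g • α).2 t ht))
    (ContinuousLinearMap.hasFDerivAt _)
  have h2 := (SO.compLeft d g).hasFDerivAt.comp (α.1, t)
    (hasFDerivAt_linHomotopy (mem_homotopyDomain α.1 α.2 t ht))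
  have h3 : (fun q : LinMap d m × ℝ => linHomotopy (SO.compLeft d g q.1, q.2)) =
      SO.compLeft d g ∘ linHomotopy := funext (linHomotopy_compLeft g)
  rw [h3] at h1
  exact DFunLike.congr_fun (h1.unique h2) w

/-- The homotopy intertwines `g × id` with `g`. The pullback of a `g`-invariant form is therefore
invariant under `g × id`; invariance of `θ` is used at the point `β` that the homotopy reaches at
time `t`. -/
lemma homotopyPull_compLeft {p : ℕ} {θ : DiffForm (LinMap d m) (Inj d m) p}
    (hθ : θ ∈ invariantForms (LinMap d m) (Inj d m) (SO m) p) (g : SO m) (α : Inj d m) {t : ℝ}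
    (ht : t ∈ Icc (0 : ℝ) 1) (w : Fin p → LinMap d m × ℝ) :
    homotopyPull θ.field (SO.compLeft d g α.1, t) (fun i => (SO.compLeft d g (w i).1, (w i).2)) =
      homotopyPull θ.field (α.1, t) w := by
  have hm := (mem_homotopyDomain α.1 α.2 t ht).2
  set β : Inj d m := ⟨linHomotopy (α.1, t), hm⟩ with hβ
  have h1 : flat θ.field (linHomotopy (SO.compLeft d g α.1, t)) = θ.field (g • β) := by
    rw [linHomotopy_compLeft g (α.1, t)]
    exact flat_coe θ.field (g • β)
  have h2 : flat θ.field (linHomotopy (α.1, t)) = θ.field β := flat_coe θ.field β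
  have h3 : θ.field β = (θ.field (g • β)).compContinuousLinearMap (SO.compLeft d g) := by
    rw [← differentialAt_smul_inj g β]
    exact (congrFun (hθ g) β).symm
  simp only [homotopyPull]
  rw [h1, h2, h3]
  change θ.field (g • β) (fun i => fderiv ℝ linHomotopy (SO.compLeft d g α.1, t)
    (SO.compLeft d g (w i).1, (w i).2)) = θ.field (g • β)
      (fun i => SO.compLeft d g (fderiv ℝ linHomotopy (α.1, t) (w i)))
  simp only [fderiv_linHomotopy_compLeft g α ht]

/-- The homotopy operator preserves invariant forms. -/
lemma homotopyOperator_mem_invariantForms {p : ℕ} {θ : DiffForm (LinMap d m) (Inj d m) (p + 1)}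
    (hθ : θ ∈ invariantForms (LinMap d m) (Inj d m) (SO m) (p + 1)) :
    homotopyOperator d m p θ ∈ invariantForms (LinMap d m) (Inj d m) (SO m) p := by
  intro g
  ext1 α
  have hint : Integrable fun t : Icc (0 : ℝ) 1 =>
      contractCLM _ p (homotopyPull θ.field ((g • α).1, t)) :=
    integrable_slice ((contractCLM _ p).continuous.comp_continuousOn
      (contDiffOn_homotopyPull θ.smooth).continuousOn) (mem_homotopyDomain _ (g • α).2)
  -- `g` acts linearly, so its differential is the same at every point. Pulling back by it is one
  -- fixed continuous linear map, which passes through the integral.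
  let C : LinMap d m [⋀^Fin p]→L[ℝ] ℝ →L[ℝ] LinMap d m [⋀^Fin p]→L[ℝ] ℝ :=
    ContinuousAlternatingMap.compContinuousLinearMapCLM (SO.compLeft d g)
  have h1 := ContinuousLinearMap.integral_comp_comm (E := LinMap d m [⋀^Fin p]→L[ℝ] ℝ)
    (Fₗ := LinMap d m [⋀^Fin p]→L[ℝ] ℝ) (𝕜 := ℝ) C hint
  have h2 : pull (g • · : Inj d m → Inj d m) (homotopyOperator d m p θ).field α =
      ((homotopyOperator d m p θ).field (g • α)).compContinuousLinearMap (SO.compLeft d g) := by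
    rw [← differentialAt_smul_inj g α]
    rfl
  refine h2.trans (h1.symm.trans ?_)
  refine integral_congr_ae (Filter.Eventually.of_forall fun t => ?_)
  ext v
  rw [contractCLM_apply]
  refine Eq.trans ?_ (homotopyPull_compLeft hθ g α t.2 _)
  change homotopyPull θ.field ((g • α).1, (t : ℝ)) _ = homotopyPull θ.field ((g • α).1, (t : ℝ)) _
  congr 1
  ext1 i
  refine Fin.cases ?_ (fun i => ?_) i
  -- The vector `∂_t = (0, 1)` has no component in `LinMap d m`, so `g × id` fixes it.
  · simp
  · rfl

end Invariance

end StiefelForms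

end

/-! ### The main theorem -/

theorem mainTheorem3 (d m : ℕ) (hd : 1 ≤ d) (hdm : d ≤ m) :
    -- the homotopy operator `θ ↦ π_* (homotopy^* θ)` and the homotopy formula
    (∃ K : ∀ p, DiffForm (LinMap d m) (Inj d m) (p + 1) →ₗ[ℝ] DiffForm (LinMap d m) (Inj d m) p,
      (∀ (p : ℕ) (θ : DiffForm (LinMap d m) (Inj d m) (p + 1)),
        (K p θ).field = fibreIntegral (pullbackField (𝓘(ℝ, LinMap d m).prod (𝓡∂ 1))
          𝓘(ℝ, LinMap d m) (homotopy m d) θ.field)) ∧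
      (∀ θ : DiffForm (LinMap d m) (Inj d m) 0,
        pull (gramSchmidtMap m d) (pull (E := StiefelModel m d) (incl m d) θ.field) - θ.field =
          (K 0 (extD (LinMap d m) (Inj d m) 0 θ)).field) ∧
      (∀ (p : ℕ) (θ : DiffForm (LinMap d m) (Inj d m) (p + 1)),
        pull (gramSchmidtMap m d) (pull (E := StiefelModel m d) (incl m d) θ.field) - θ.field =
          (K (p + 1) (extD (LinMap d m) (Inj d m) (p + 1) θ) +
            extD (LinMap d m) (Inj d m) p (K p θ)).field) ∧
      (∀ p : ℕ, ∀ θ ∈ invariantForms (LinMap d m) (Inj d m) (SO m) (p + 1),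
        K p θ ∈ invariantForms (LinMap d m) (Inj d m) (SO m) p)) ∧
    -- `ι^*` and `Λ^*` are inverse isomorphisms of the de Rham cohomologies
    (∀ p : ℕ, ∃ e : Cohomology (allForms (LinMap d m) (Inj d m)) p ≃ₗ[ℝ]
        Cohomology (allForms (StiefelModel m d) (Stiefel m d)) p,
      IsInducedByPullback (incl m d) e.toLinearMap ∧
      IsInducedByPullback (gramSchmidtMap m d) e.symm.toLinearMap) ∧
    -- the same for the `SO(m)`-invariant de Rham cohomologies
    (∀ p : ℕ, ∃ e : Cohomology (invariantForms (LinMap d m) (Inj d m) (SO m)) p ≃ₗ[ℝ]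
        Cohomology (invariantForms (StiefelModel m d) (Stiefel m d) (SO m)) p,
      IsInducedByPullback (incl m d) e.toLinearMap ∧
      IsInducedByPullback (gramSchmidtMap m d) e.symm.toLinearMap) := by
  refine ⟨⟨homotopyOperator d m, fun p θ => funext fun α =>
      (fibreIntegral_pullbackField_homotopy θ.field α).symm, homotopy_formula_zero,
      fun p θ => homotopy_formula_succ θ, fun p θ hθ => homotopyOperator_mem_invariantForms hθ⟩,
    fun p => ?_, fun p => ?_⟩
  · exact exists_cohomology_equiv contMDiff_incl contMDiff_gramSchmidtMap gramSchmidtMap_comp_incl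
      (fun _ _ _ => Submodule.mem_top) (fun _ _ _ => Submodule.mem_top) (homotopyOperator d m)
      (fun _ _ _ => Submodule.mem_top) (fun θ => DiffForm.ext (homotopy_formula_zero θ))
      (fun p θ => DiffForm.ext (homotopy_formula_succ θ)) p
  -- The same algebra applies to the invariant families, because `ι^*`, `Λ^*` and the homotopy
  -- operator all preserve invariance.
  · have hI := fun g : SO m => (contMDiff_smul_inj (d := d) g).mdifferentiable (by simp)
    have hS := fun g : SO m => (contMDiff_smul_stiefel (d := d) g).mdifferentiable (by simp)
    exact exists_cohomology_equiv contMDiff_incl contMDiff_gramSchmidtMap gramSchmidtMap_comp_incl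
      (fun p θ hθ => pullForm_mem_invariantForms contMDiff_incl incl_smul hS hI hθ)
      (fun p θ hθ => pullForm_mem_invariantForms contMDiff_gramSchmidtMap gramSchmidtMap_smul hI hS hθ)
      (homotopyOperator d m) (fun p θ hθ => homotopyOperator_mem_invariantForms hθ)
      (fun θ => DiffForm.ext (homotopy_formula_zero θ))
      (fun p θ => DiffForm.ext (homotopy_formula_succ θ)) p
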